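/- Let $M$ be a finite-dimensional (Hausdorff, boundaryless) $C^\infty$ manifold, $h\ge 0$ an integer and $\tau=\sum_{a=1}^h c_a t^a$ a linear function on $\mathbb R^h$ ($c_a\in\mathbb R$). All objects are of class $C^\infty$. *Dirac structures.* On the big tangent bundle $T^{big}N=TN\oplus T^*N$ of a manifold $N$ put $G(X\oplus\alpha,Y\oplus\beta)=\frac12(\beta(X)+\alpha(Y))$, $\Omega(X\oplus\alpha,Y\oplus\beta)=\frac12(\beta(X)-\alpha(Y))$, and let $$[X\oplus\alpha,Y\oplus\beta]=[X,Y]\oplus\bigl(L_X\beta-L_Y\alpha-d(\Omega(X\oplus\alpha,Y\oplus\beta))\bigr)$$ be the (untwisted) Courant bracket of global sections. A Dirac structure on $N$ is a smooth subbundle $D\subseteq T^{big}N$ whose fibers are maximal $G$-isotropic and whose space of global sections $\Gamma D$ is closed under the Courant bracket. For $\sigma\in C^\infty(N)$ let $\mathcal C_\sigma(X\oplus\alpha)=X\oplus e^{\sigma}\alpha$. *Stable structures.* On $\mathbf T^{big}_hM=(TM\times\mathbb R^h)\oplus(T^*M\times\mathbb R^h)$ put $$G((X_1,u_1)\oplus(\alpha_1,v_1),(X_2,u_2)\oplus(\alpha_2,v_2))=\tfrac12(\alpha_2(X_1)+\alpha_1(X_2)+u_1\cdot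 v_2+u_2\cdot v_1).$$ A stable almost Dirac structure of index $h$ on $M$ is a smooth subbundle $J\subseteq\mathbf T^{big}_hM$ whose fibers are maximal $G$-isotropic. It is called (untwisted) Dirac–Jacobi, with respect to $\tau$, if $\Gamma J$ is closed under the untwisted Wade bracket $$[(X_1,u_1)\oplus(\alpha_1,v_1),(X_2,u_2)\oplus(\alpha_2,v_2)]_W=([X_1,X_2],X_1u_2-X_2u_1)\oplus(\alpha,v),$$ $$\alpha=L_{X_1}\alpha_2-L_{X_2}\alpha_1+\tfrac12 d(\alpha_1(X_2)-\alpha_2(X_1))+d_0\tau(u_1)\alpha_2-d_0\tau(u_2)\alpha_1+\tfrac12(u_2\cdot dv_1+v_2\cdot du_1-u_1\cdot dv_2-v_1\cdot du_2),$$ $$v=X_1v_2-X_2v_1+\tfrac12(\alpha_1(X_2)-\alpha_2(X_1)+u_2\cdot v_1-u_1\cdot v_2)\,d_0\tau+d_0\tau(u_1)v_2-d_0\tau(u_2)v_1,$$ where $d_0\tau=(c_1,\dots,c_h)$ is the differential of $\tau$ at $0$. For a stable almost Dirac structure $J$ of index $h$ on $M$ let $\tilde J$ be the translation invariant subbundle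 of $T^{big}(M\times\mathbb R^h)$ with fiber $$\tilde J_{(x,t)}=\Bigl\{\bigl(X+\sum_a u^a\tfrac{\partial}{\partial t^a}\bigr)\oplus\bigl(\alpha+\sum_a v_a\,dt^a\bigr)\;:\;(X,u)\oplus(\alpha,v)\in J_x\Bigr\}$$ at $(x,t)\in M\times\mathbb R^h$, and regard $\tau$ as a function on $M\times\mathbb R^h$. **Proposition.** Let $J$ be a stable almost Dirac structure of index $h$ on $M$. Then $J$ is Dirac–Jacobi with respect to $\tau$ if and only if $\mathcal C_\tau(\tilde J)$ is a Dirac structure on the manifold $M\times\mathbb R^h$. -/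

import Mathlib

open Set Function Bundle VectorField
open scoped Manifold ContDiff Topology

namespace StableDirac

/-! ### Calculus of vector fields and one-forms on a manifold -/

noncomputable section Calculus

variable {E : Type*} [NormedAddCommGroup E] [NormedSpace ℝ E]
  {H : Type*} [TopologicalSpace H] (I : ModelWithCorners ℝ E H)
  {M : Type*} [TopologicalSpace M] [ChartedSpace H M]

/-- The cotangent space of `M` at `x`. -/
abbrev CotangentSpace (x : M) : Type _ := TangentSpace I x →L[ℝ] ℝ

/-- The vector field `X` is smooth (i.e. `C^∞`) on `U`. -/
def SmoothVectorFieldOn [IsManifold I ∞ M] (X : Π x : M, TangentSpace I x) (U : Set M) : Prop :=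
  ContMDiffOn I I.tangent ∞ (fun x => (⟨x, X x⟩ : TangentBundle I M)) U

/-- The one-form `α` is smooth (i.e. `C^∞`) on `U`, as a section of the bundle of continuous
linear maps from the tangent bundle to the trivial line bundle. -/
def SmoothOneFormOn [IsManifold I ∞ M] (α : Π x : M, CotangentSpace I x) (U : Set M) : Prop :=
  ContMDiffOn I (I.prod 𝓘(ℝ, E →L[ℝ] ℝ)) ∞
    (fun x => (TotalSpace.mk' (E →L[ℝ] ℝ) x (α x) :
      TotalSpace (E →L[ℝ] ℝ) (fun x : M => TangentSpace I x →L[ℝ] ℝ))) U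

/-- The differential `df` of a real function. -/
def dFun (f : M → ℝ) (x : M) : CotangentSpace I x := mfderiv I 𝓘(ℝ, ℝ) f x

/-- The derivative `X f` of a function `f` with values in a normed space along a vector field. -/
def along {F : Type*} [NormedAddCommGroup F] [NormedSpace ℝ F]
    (X : Π x : M, TangentSpace I x) (f : M → F) (x : M) : F :=
  mfderiv I 𝓘(ℝ, F) f x (X x)

/-- The one-form `α` read in the preferred chart at `x₀`: its pullback, to the model vector space,
by the inverse of the chart. -/
def oneFormInChart (α : Π x : M, CotangentSpace I x) (x₀ : M) (z : E) : E →L[ℝ] ℝ :=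
  (α ((extChartAt I x₀).symm z)).comp
    (mfderivWithin 𝓘(ℝ, E) I (extChartAt I x₀).symm (range I) z)

/-- The exterior derivative of a one-form, evaluated on two tangent vectors at `x`. It is computed
in the preferred chart at `x`, with the normalization
`dα(X, Y) = X (α(Y)) - Y (α(X)) - α([X, Y])`. -/
def dOneForm (α : Π x : M, CotangentSpace I x) (x : M) (v : TangentSpace I x) :
    CotangentSpace I x :=
  let φ : TangentSpace I x →L[ℝ] E := mfderiv I 𝓘(ℝ, E) (extChartAt I x) x
  let D : E →L[ℝ] E →L[ℝ] ℝ :=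
    fderivWithin ℝ (oneFormInChart I α x) (range I) (extChartAt I x x)
  (D (φ v) - D.flip (φ v)).comp φ

/-- The Lie derivative `L_X α = i(X) dα + d(α(X))` of a one-form along a vector field. -/
def lieOneForm (X : Π x : M, TangentSpace I x) (α : Π x : M, CotangentSpace I x) (x : M) :
    CotangentSpace I x :=
  dOneForm I α x (X x) + dFun I (fun y => α y (X y)) x

end Calculus

/-! ### Subbundles -/

section Subbundles

/-- `W` is maximal among the subspaces that are isotropic for the form `B`. -/
def IsMaximalIsotropic {V : Type*} [AddCommGroup V] [Module ℝ V] (B : V → V → ℝ)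
    (W : Submodule ℝ V) : Prop :=
  Maximal (fun W' : Submodule ℝ V => ∀ a ∈ W', ∀ b ∈ W', B a b = 0) W

/-- A field `D` of subspaces of the fibers `V x` is a smooth subbundle if it has, around every
point, a smooth local frame. Here `Smooth s U` says that the section `s` is smooth on `U`; the
values of a local section outside of `U` are irrelevant. -/
def IsSmoothSubbundle {M : Type*} [TopologicalSpace M] {V : M → Type*}
    [∀ x, AddCommGroup (V x)] [∀ x, Module ℝ (V x)]
    (Smooth : (Π x, V x) → Set M → Prop) (D : Π x, Submodule ℝ (V x)) : Prop :=
  ∀ x₀ : M, ∃ U : Set M, IsOpen U ∧ x₀ ∈ U ∧ ∃ (r : ℕ) (e : Fin r → Π x, V x),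
    (∀ i, Smooth (e i) U) ∧
    ∀ x ∈ U, LinearIndependent ℝ (fun i => e i x) ∧
      Submodule.span ℝ (range fun i => e i x) = D x

end Subbundles

/-! ### The big tangent bundle and Dirac structures -/

noncomputable section Big

variable {E : Type*} [NormedAddCommGroup E] [NormedSpace ℝ E]
  {H : Type*} [TopologicalSpace H] (I : ModelWithCorners ℝ E H)
  {M : Type*} [TopologicalSpace M] [ChartedSpace H M]

/-- The fiber at `x` of the big tangent bundle `TM ⊕ T*M`; its elements `(X, α)` stand for
`X ⊕ α`. -/
abbrev Big (x : M) : Type _ := TangentSpace I x × CotangentSpace I x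

/-- The section `s` of the big tangent bundle is smooth on `U`. -/
def SmoothBigOn [IsManifold I ∞ M] (s : Π x : M, Big I x) (U : Set M) : Prop :=
  SmoothVectorFieldOn I (fun x => (s x).1) U ∧ SmoothOneFormOn I (fun x => (s x).2) U

/-- The neutral metric `G` of the big tangent bundle. -/
def bigMetric (x : M) (a b : Big I x) : ℝ := (1 / 2) * (b.2 a.1 + a.2 b.1)

/-- The `2`-form `Ω` of the big tangent bundle. -/
def bigOmega (x : M) (a b : Big I x) : ℝ := (1 / 2) * (b.2 a.1 - a.2 b.1)

/-- The (untwisted) Courant bracket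
`[X ⊕ α, Y ⊕ β] = [X, Y] ⊕ (L_X β - L_Y α - d(Ω(X ⊕ α, Y ⊕ β)))`. -/
def courantBracket (s₁ s₂ : Π x : M, Big I x) (x : M) : Big I x :=
  (mlieBracket I (fun y => (s₁ y).1) (fun y => (s₂ y).1) x,
    lieOneForm I (fun y => (s₁ y).1) (fun y => (s₂ y).2) x
      - lieOneForm I (fun y => (s₂ y).1) (fun y => (s₁ y).2) x
      - dFun I (fun y => bigOmega I y (s₁ y) (s₂ y)) x)

/-- An almost Dirac structure: a maximally isotropic smooth subbundle of `TM ⊕ T*M`. -/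
structure IsAlmostDirac [IsManifold I ∞ M] (D : Π x : M, Submodule ℝ (Big I x)) : Prop where
  isSmoothSubbundle : IsSmoothSubbundle (SmoothBigOn I) D
  isMaximalIsotropic : ∀ x, IsMaximalIsotropic (bigMetric I x) (D x)

/-- A Dirac structure: an almost Dirac structure whose global smooth sections are closed under the
Courant bracket. -/
structure IsDirac [IsManifold I ∞ M] (D : Π x : M, Submodule ℝ (Big I x)) : Prop
    extends IsAlmostDirac I D where
  closed : ∀ s₁ s₂ : Π x : M, Big I x, SmoothBigOn I s₁ univ → SmoothBigOn I s₂ univ →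
    (∀ x, s₁ x ∈ D x) → (∀ x, s₂ x ∈ D x) → ∀ x, courantBracket I s₁ s₂ x ∈ D x

/-- The conformal change `C_τ (X ⊕ α) = X ⊕ e^τ α` on the fiber at `x`. -/
def conformalMap (τ : M → ℝ) (x : M) : Big I x →ₗ[ℝ] Big I x :=
  LinearMap.prodMap LinearMap.id (Real.exp (τ x) • LinearMap.id)

/-- The conformal change `C_τ(D)` of a field of subspaces of the big tangent bundle. -/
def conformalChange (τ : M → ℝ) (D : Π x : M, Submodule ℝ (Big I x)) (x : M) :
    Submodule ℝ (Big I x) :=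
  (D x).map (conformalMap I τ x)

end Big

/-! ### The stable big tangent bundle and stable Dirac-Jacobi structures -/

noncomputable section Stable

variable {E : Type*} [NormedAddCommGroup E] [NormedSpace ℝ E]
  {H : Type*} [TopologicalSpace H] (I : ModelWithCorners ℝ E H) (h : ℕ)
  {M : Type*} [TopologicalSpace M] [ChartedSpace H M]

/-- The Euclidean space `ℝ^h`. -/
abbrev RSpace (h : ℕ) : Type := EuclideanSpace ℝ (Fin h)

/-- The fiber at `x` of the stable big tangent bundle of index `h`,
`(TM × ℝ^h) ⊕ (T*M × ℝ^h)`; its elements `((X, u), (α, v))` stand for `(X, u) ⊕ (α, v)`. -/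
abbrev StableBig (x : M) : Type _ :=
  (TangentSpace I x × RSpace h) × (CotangentSpace I x × RSpace h)

/-- The section `s` of the stable big tangent bundle is smooth on `U`. -/
structure SmoothStableOn [IsManifold I ∞ M] (s : Π x : M, StableBig I h x) (U : Set M) :
    Prop where
  smooth_X : SmoothVectorFieldOn I (fun x => (s x).1.1) U
  smooth_u : ContMDiffOn I 𝓘(ℝ, RSpace h) ∞ (fun x => (s x).1.2) U
  smooth_α : SmoothOneFormOn I (fun x => (s x).2.1) U
  smooth_v : ContMDiffOn I 𝓘(ℝ, RSpace h) ∞ (fun x => (s x).2.2) U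

/-- The neutral metric `G` of the stable big tangent bundle. -/
def stableMetric (x : M) (a b : StableBig I h x) : ℝ :=
  (1 / 2) * (b.2.1 a.1.1 + a.2.1 b.1.1 + inner ℝ a.1.2 b.2.2 + inner ℝ b.1.2 a.2.2)

variable {h} in
/-- The one-form `u · dv = ∑ a, u^a dv_a` for functions `u, v : M → ℝ^h`. -/
def dotD (u v : M → RSpace h) (x : M) : CotangentSpace I x :=
  ∑ a : Fin h, u x a • dFun I (fun y => v y a) x

/-- The untwisted Wade (Courant-Jacobi) bracket of index `h`, for a function `τ` on `ℝ^h`: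
`[(X₁, u₁) ⊕ (α₁, v₁), (X₂, u₂) ⊕ (α₂, v₂)]_W = ([X₁, X₂], X₁ u₂ - X₂ u₁) ⊕ (α, v)` with
`α = L_{X₁} α₂ - L_{X₂} α₁ + ½ d(α₁(X₂) - α₂(X₁)) + d₀τ(u₁) α₂ - d₀τ(u₂) α₁
  + ½ (u₂ · dv₁ + v₂ · du₁ - u₁ · dv₂ - v₁ · du₂)` and
`v = X₁ v₂ - X₂ v₁ + ½ (α₁(X₂) - α₂(X₁) + u₂ · v₁ - u₁ · v₂) d₀τ + d₀τ(u₁) v₂ - d₀τ(u₂) v₁`,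
where the covector `d₀τ` is `fderiv ℝ τ 0`, and is seen as the vector `gradient τ 0` of its
components in the last formula. -/
def wadeBracket (τ : RSpace h → ℝ) (s₁ s₂ : Π x : M, StableBig I h x) (x : M) :
    StableBig I h x :=
  let X₁ : Π y : M, TangentSpace I y := fun y => (s₁ y).1.1
  let u₁ : M → RSpace h := fun y => (s₁ y).1.2
  let α₁ : Π y : M, CotangentSpace I y := fun y => (s₁ y).2.1
  let v₁ : M → RSpace h := fun y => (s₁ y).2.2
  let X₂ : Π y : M, TangentSpace I y := fun y => (s₂ y).1.1
  let u₂ : M → RSpace h := fun y => (s₂ y).1.2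
  let α₂ : Π y : M, CotangentSpace I y := fun y => (s₂ y).2.1
  let v₂ : M → RSpace h := fun y => (s₂ y).2.2
  let dτ : RSpace h →L[ℝ] ℝ := fderiv ℝ τ 0
  ((mlieBracket I X₁ X₂ x, along I X₁ u₂ x - along I X₂ u₁ x),
    (lieOneForm I X₁ α₂ x - lieOneForm I X₂ α₁ x
        + (1 / 2 : ℝ) • dFun I (fun y => α₁ y (X₂ y) - α₂ y (X₁ y)) x
        + dτ (u₁ x) • α₂ x - dτ (u₂ x) • α₁ x
        + (1 / 2 : ℝ) • (dotD I u₂ v₁ x + dotD I v₂ u₁ x - dotD I u₁ v₂ x - dotD I v₁ u₂ x),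
      along I X₁ v₂ x - along I X₂ v₁ x
        + ((1 / 2) * (α₁ x (X₂ x) - α₂ x (X₁ x) + inner ℝ (u₂ x) (v₁ x) - inner ℝ (u₁ x) (v₂ x)))
          • gradient τ 0
        + dτ (u₁ x) • v₂ x - dτ (u₂ x) • v₁ x))

/-- A stable almost Dirac structure of index `h`: a maximally isotropic smooth subbundle of the
stable big tangent bundle. -/
structure IsStableAlmostDirac [IsManifold I ∞ M] (J : Π x : M, Submodule ℝ (StableBig I h x)) :
    Prop where
  isSmoothSubbundle : IsSmoothSubbundle (SmoothStableOn I h) J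
  isMaximalIsotropic : ∀ x, IsMaximalIsotropic (stableMetric I h x) (J x)

variable {h} in
/-- The linear function `τ = ∑ a, c_a t^a` on `ℝ^h`. -/
def linearFun (c : Fin h → ℝ) (t : RSpace h) : ℝ := ∑ a, c a * t a

/-- An (untwisted) stable Dirac-Jacobi structure of index `h`, for the linear function
`τ = ∑ a, c_a t^a`: a stable almost Dirac structure whose global smooth sections are closed under
the Wade bracket. -/
structure IsStableDiracJacobi [IsManifold I ∞ M] (c : Fin h → ℝ)
    (J : Π x : M, Submodule ℝ (StableBig I h x)) : Prop
    extends IsStableAlmostDirac I h J where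
  closed : ∀ s₁ s₂ : Π x : M, StableBig I h x,
    SmoothStableOn I h s₁ univ → SmoothStableOn I h s₂ univ →
    (∀ x, s₁ x ∈ J x) → (∀ x, s₂ x ∈ J x) → ∀ x, wadeBracket I h (linearFun c) s₁ s₂ x ∈ J x

/-- The identification of `(X, u) ⊕ (α, v)`, at the point `p.1` of `M`, with the element
`(X + ∑ a, u^a ∂/∂t^a) ⊕ (α + ∑ a, v_a dt^a)` of the big tangent bundle of `M × ℝ^h` at the point
`p = (p.1, p.2)`. The tangent space of the product at `p` is the product of the tangent spaces, so
that the vector is the pair `(X, u)`, and the covector is `(Y, w) ↦ α(Y) + v · w`. -/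
def invariantLift (p : M × RSpace h) :
    StableBig I h p.1 →ₗ[ℝ] Big (I.prod 𝓘(ℝ, RSpace h)) p where
  toFun e := ((e.1.1, e.1.2), e.2.1.coprod (innerSL ℝ e.2.2))
  map_add' a b := by
    refine Prod.ext rfl (ContinuousLinearMap.ext ?_)
    rintro ⟨y, w⟩
    change (a.2.1 y + b.2.1 y) + innerSL ℝ (a.2.2 + b.2.2) w
      = (a.2.1 y + innerSL ℝ a.2.2 w) + (b.2.1 y + innerSL ℝ b.2.2 w)
    simp only [innerSL_apply_apply, inner_add_left]
    ring
  map_smul' r a := by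
    refine Prod.ext rfl (ContinuousLinearMap.ext ?_)
    rintro ⟨y, w⟩
    change r * a.2.1 y + innerSL ℝ (r • a.2.2) w = r * (a.2.1 y + innerSL ℝ a.2.2 w)
    simp only [innerSL_apply_apply, real_inner_smul_left]
    ring

/-- The translation invariant field `J̃` of subspaces of the big tangent bundle of `M × ℝ^h` that
extends `J`: its value at `(x, t)` is the translate of `J x`. -/
def invariantExtension (J : Π x : M, Submodule ℝ (StableBig I h x)) (p : M × RSpace h) :
    Submodule ℝ (Big (I.prod 𝓘(ℝ, RSpace h)) p) :=
  (J p.1).map (invariantLift I h p)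

end Stable

end StableDirac

namespace StableDirac

noncomputable section Charts

variable {E : Type*} [NormedAddCommGroup E] [NormedSpace ℝ E]
  {H : Type*} [TopologicalSpace H] (I : ModelWithCorners ℝ E H)
  {M : Type*} [TopologicalSpace M] [ChartedSpace H M]

/-- The vector field `X` read in the preferred chart at `x₀`. -/
def vectorFieldInChart (X : Π x : M, TangentSpace I x) (x₀ : M) : E → E :=
  mpullbackWithin 𝓘(ℝ, E) I (extChartAt I x₀).symm X (range I)

lemma contMDiffAt_iff_contDiffAt_chart [I.Boundaryless] {F : Type*} [NormedAddCommGroup F]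
    [NormedSpace ℝ F] {f : M → F} {x₀ : M} :
    ContMDiffAt I 𝓘(ℝ, F) ∞ f x₀ ↔
      ContDiffAt ℝ ∞ (fun z => f ((extChartAt I x₀).symm z)) (extChartAt I x₀ x₀) := by
  rw [contMDiffAt_iff_source, I.range_eq_univ, contMDiffWithinAt_univ,
    contMDiffAt_iff_contDiffAt]
  rfl

variable [IsManifold I ∞ M]

lemma contMDiffAt_vectorField_iff [I.Boundaryless] {X : Π x : M, TangentSpace I x} {x₀ : M} :
    ContMDiffAt I I.tangent ∞ (fun x => (⟨x, X x⟩ : TangentBundle I M)) x₀ ↔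
      ContDiffAt ℝ ∞ (vectorFieldInChart I X x₀) (extChartAt I x₀ x₀) := by
  have : IsManifold I 1 M := .of_le (n := ∞) (by simp)
  rw [contMDiffAt_section, contMDiffAt_iff_contDiffAt_chart]
  suffices h : (fun z => (trivializationAt E (TangentSpace I) x₀
      ⟨(extChartAt I x₀).symm z, X ((extChartAt I x₀).symm z)⟩).2) =ᶠ[𝓝 (extChartAt I x₀ x₀)]
      vectorFieldInChart I X x₀ from ⟨fun H => H.congr_of_eventuallyEq h.symm,
        fun H => H.congr_of_eventuallyEq h⟩
  filter_upwards [(isOpen_extChartAt_target x₀).mem_nhds (mem_extChartAt_target x₀)] with z hz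
  have hb : (extChartAt I x₀).symm z ∈ (chartAt H x₀).source := by
    simpa using (extChartAt I x₀).map_target hz
  have h1 : (trivializationAt E (TangentSpace I) x₀).continuousLinearMapAt ℝ
      ((extChartAt I x₀).symm z) (X ((extChartAt I x₀).symm z))
      = (trivializationAt E (TangentSpace I) x₀
        ⟨(extChartAt I x₀).symm z, X ((extChartAt I x₀).symm z)⟩).2 :=
    congrFun ((trivializationAt E (TangentSpace I) x₀).coe_linearMapAt_of_mem (R := ℝ)
      (by simpa using hb)) _
  rw [← h1, TangentBundle.continuousLinearMapAt_trivializationAt hb]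
  have h3 := isInvertible_mfderivWithin_extChartAt_symm hz
  have h4 := congrArg (fun L => L (X ((extChartAt I x₀).symm z)))
    (mfderivWithin_extChartAt_symm_comp_mfderiv_extChartAt hz)
  exact (h3.inverse_apply_eq.2 h4.symm).symm

lemma contMDiffAt_oneForm_iff [I.Boundaryless] {α : Π x : M, CotangentSpace I x} {x₀ : M} :
    ContMDiffAt I (I.prod 𝓘(ℝ, E →L[ℝ] ℝ)) ∞ (fun x => (TotalSpace.mk' (E →L[ℝ] ℝ) x (α x) :
      TotalSpace (E →L[ℝ] ℝ) (fun x : M => TangentSpace I x →L[ℝ] ℝ))) x₀ ↔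
      ContDiffAt ℝ ∞ (oneFormInChart I α x₀) (extChartAt I x₀ x₀) := by
  have : IsManifold I 1 M := .of_le (n := ∞) (by simp)
  rw [contMDiffAt_section, contMDiffAt_iff_contDiffAt_chart]
  suffices h : (fun z => (trivializationAt (E →L[ℝ] ℝ) (fun x : M => TangentSpace I x →L[ℝ] ℝ) x₀
      ⟨(extChartAt I x₀).symm z, α ((extChartAt I x₀).symm z)⟩).2) =ᶠ[𝓝 (extChartAt I x₀ x₀)]
      oneFormInChart I α x₀ from ⟨fun H => H.congr_of_eventuallyEq h.symm,
        fun H => H.congr_of_eventuallyEq h⟩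
  filter_upwards [(isOpen_extChartAt_target x₀).mem_nhds (mem_extChartAt_target x₀)] with z hz
  have hb : (extChartAt I x₀).symm z ∈ (chartAt H x₀).source := by
    simpa using (extChartAt I x₀).map_target hz
  have h1 := TangentBundle.symmL_trivializationAt (I := I) (𝕜 := ℝ) hb
  rw [(extChartAt I x₀).right_inv hz] at h1
  rw [hom_trivializationAt_apply]
  ext v
  have h2 := congrArg (fun L => α ((extChartAt I x₀).symm z) (L v)) h1
  simpa [ContinuousLinearMap.inCoordinates, oneFormInChart] using! h2

lemma vectorFieldInChart_self (X : Π x : M, TangentSpace I x) (x : M) :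
    vectorFieldInChart I X x (extChartAt I x x) = X x := by
  have : IsManifold I 1 M := .of_le (n := ∞) (by simp)
  rw [vectorFieldInChart, mpullbackWithin_apply, extChartAt_to_inv]
  exact mfderivWithin_extChartAt_symm_inverse_apply _

lemma oneFormInChart_self (α : Π x : M, CotangentSpace I x) (x : M) :
    oneFormInChart I α x (extChartAt I x x) = α x := by
  have : IsManifold I 1 M := .of_le (n := ∞) (by simp)
  rw [oneFormInChart, mfderivWithin_range_extChartAt_symm, extChartAt_to_inv]
  rfl

/-- The contraction `α(X)` can be computed in a chart. -/
lemma oneFormInChart_apply_vectorFieldInChart (X : Π x : M, TangentSpace I x)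
    (α : Π x : M, CotangentSpace I x) (x₀ : M) {z : E} (hz : z ∈ (extChartAt I x₀).target) :
    oneFormInChart I α x₀ z (vectorFieldInChart I X x₀ z)
      = α ((extChartAt I x₀).symm z) (X ((extChartAt I x₀).symm z)) := by
  have : IsManifold I 1 M := .of_le (n := ∞) (by simp)
  have h3 := isInvertible_mfderivWithin_extChartAt_symm hz
  have h4 := (h3.inverse_apply_eq (y := X ((extChartAt I x₀).symm z))
    (x := mpullbackWithin 𝓘(ℝ, E) I (extChartAt I x₀).symm X (range I) z)).1 rfl
  exact congrArg (α ((extChartAt I x₀).symm z)) h4.symm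

variable [I.Boundaryless]

omit [IsManifold I ∞ M] in
/-- The derivative of a smooth function, computed in the preferred chart. -/
lemma mfderiv_eq_fderiv_chart {F : Type*} [NormedAddCommGroup F] [NormedSpace ℝ F] {f : M → F}
    {x : M} (hf : ContMDiffAt I 𝓘(ℝ, F) ∞ f x) :
    mfderiv I 𝓘(ℝ, F) f x
      = fderiv ℝ (fun z => f ((extChartAt I x).symm z)) (extChartAt I x x) := by
  have h := hf.mdifferentiableAt (by simp)
  have h1 : mfderiv I 𝓘(ℝ, F) f x
      = fderivWithin ℝ (writtenInExtChartAt I 𝓘(ℝ, F) x f) (range I) (extChartAt I x x) := by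
    unfold mfderiv
    exact if_pos h
  rw [h1, I.range_eq_univ]
  exact congrFun fderivWithin_univ _

lemma mlieBracket_eq_chart (X Y : Π x : M, TangentSpace I x) (x : M) :
    mlieBracket I X Y x =
      fderiv ℝ (vectorFieldInChart I Y x) (extChartAt I x x)
          (vectorFieldInChart I X x (extChartAt I x x))
        - fderiv ℝ (vectorFieldInChart I X x) (extChartAt I x x)
          (vectorFieldInChart I Y x (extChartAt I x x)) := by
  have : IsManifold I 1 M := .of_le (n := ∞) (by simp)
  have h (v : TangentSpace I x) : (mfderiv I 𝓘(ℝ, E) (extChartAt I x) x).inverse v = v := by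
    rw [mfderiv_extChartAt_self]
    exact congrArg (fun L : E →L[ℝ] E => L v) ContinuousLinearMap.inverse_id
  have h1 : lieBracketWithin ℝ (vectorFieldInChart I X x) (vectorFieldInChart I Y x)
      ((extChartAt I x).symm ⁻¹' univ ∩ range I)
      = lieBracket ℝ (vectorFieldInChart I X x) (vectorFieldInChart I Y x) := by
    rw [preimage_univ, univ_inter, I.range_eq_univ, lieBracketWithin_univ]
  refine (h _).trans (Eq.trans ?_ (congrFun (lieBracket_eq (𝕜 := ℝ)) (extChartAt I x x)))
  exact congrFun h1 (extChartAt I x x)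

lemma dOneForm_eq_chart (α : Π x : M, CotangentSpace I x) (x : M) (v w : E) :
    (dOneForm I α x v : E →L[ℝ] ℝ) w
      = fderiv ℝ (oneFormInChart I α x) (extChartAt I x x) v w
        - fderiv ℝ (oneFormInChart I α x) (extChartAt I x x) w v := by
  have : IsManifold I 1 M := .of_le (n := ∞) (by simp)
  let φ : E →L[ℝ] E := mfderiv I 𝓘(ℝ, E) (extChartAt I x) x
  have hφ : φ = ContinuousLinearMap.id ℝ E := mfderiv_extChartAt_self
  have h : (dOneForm I α x v : E →L[ℝ] ℝ) w
      = fderivWithin ℝ (oneFormInChart I α x) (range I) (extChartAt I x x) (φ v) (φ w)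
        - fderivWithin ℝ (oneFormInChart I α x) (range I) (extChartAt I x x) (φ w) (φ v) := rfl
  rw [h, hφ, I.range_eq_univ, fderivWithin_univ]
  rfl

variable {I}

lemma contMDiffAt_contraction {X : Π x : M, TangentSpace I x} {α : Π x : M, CotangentSpace I x}
    {x : M} (hX : ContDiffAt ℝ ∞ (vectorFieldInChart I X x) (extChartAt I x x))
    (hα : ContDiffAt ℝ ∞ (oneFormInChart I α x) (extChartAt I x x)) :
    ContMDiffAt I 𝓘(ℝ, ℝ) ∞ (fun y => α y (X y)) x := by
  rw [contMDiffAt_iff_contDiffAt_chart]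
  refine (hα.clm_apply hX).congr_of_eventuallyEq ?_
  filter_upwards [(isOpen_extChartAt_target x).mem_nhds (mem_extChartAt_target x)] with z hz
  rw [oneFormInChart_apply_vectorFieldInChart I X α x hz]

lemma dFun_contraction {X : Π x : M, TangentSpace I x} {α : Π x : M, CotangentSpace I x}
    {x : M} (hX : ContDiffAt ℝ ∞ (vectorFieldInChart I X x) (extChartAt I x x))
    (hα : ContDiffAt ℝ ∞ (oneFormInChart I α x) (extChartAt I x x)) (v : E) :
    (dFun I (fun y => α y (X y)) x : E →L[ℝ] ℝ) v
      = fderiv ℝ (oneFormInChart I α x) (extChartAt I x x) v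
          (vectorFieldInChart I X x (extChartAt I x x))
        + oneFormInChart I α x (extChartAt I x x)
          (fderiv ℝ (vectorFieldInChart I X x) (extChartAt I x x) v) := by
  rw [dFun, mfderiv_eq_fderiv_chart I (contMDiffAt_contraction hX hα)]
  have h : (fun z => α ((extChartAt I x).symm z) (X ((extChartAt I x).symm z)))
      =ᶠ[𝓝 (extChartAt I x x)]
      fun z => oneFormInChart I α x z (vectorFieldInChart I X x z) := by
    filter_upwards [(isOpen_extChartAt_target x).mem_nhds (mem_extChartAt_target x)] with z hz
    rw [oneFormInChart_apply_vectorFieldInChart I X α x hz]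
  have h2 := ((hα.differentiableAt (by simp)).hasFDerivAt.clm_apply
    (hX.differentiableAt (by simp)).hasFDerivAt).fderiv
  exact (congrArg (fun L => L v) (h.fderiv_eq.trans h2)).trans (add_comm _ _)

lemma lieOneForm_eq_chart {X : Π x : M, TangentSpace I x} {α : Π x : M, CotangentSpace I x}
    {x : M} (hX : ContDiffAt ℝ ∞ (vectorFieldInChart I X x) (extChartAt I x x))
    (hα : ContDiffAt ℝ ∞ (oneFormInChart I α x) (extChartAt I x x)) (v : E) :
    (lieOneForm I X α x : E →L[ℝ] ℝ) v
      = fderiv ℝ (oneFormInChart I α x) (extChartAt I x x)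
          (vectorFieldInChart I X x (extChartAt I x x)) v
        + oneFormInChart I α x (extChartAt I x x)
          (fderiv ℝ (vectorFieldInChart I X x) (extChartAt I x x) v) := by
  have h : (lieOneForm I X α x : E →L[ℝ] ℝ) v = (dOneForm I α x (X x) : E →L[ℝ] ℝ) v
      + (dFun I (fun y => α y (X y)) x : E →L[ℝ] ℝ) v := rfl
  have h' : (dOneForm I α x (X x) : E →L[ℝ] ℝ) v
      = fderiv ℝ (oneFormInChart I α x) (extChartAt I x x)
          (vectorFieldInChart I X x (extChartAt I x x)) v
        - fderiv ℝ (oneFormInChart I α x) (extChartAt I x x) v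
          (vectorFieldInChart I X x (extChartAt I x x)) := by
    rw [vectorFieldInChart_self]
    exact dOneForm_eq_chart I α x (X x) v
  rw [h, dFun_contraction hX hα, h']
  ring

end Charts

noncomputable section Jets

variable {E : Type*} [NormedAddCommGroup E] [NormedSpace ℝ E]
  {H : Type*} [TopologicalSpace H] (I : ModelWithCorners ℝ E H) (h : ℕ)
  {M : Type*} [TopologicalSpace M] [ChartedSpace H M]

/-- The model of the fibers of the big tangent bundle. -/
abbrev BigModel (V : Type*) [NormedAddCommGroup V] [NormedSpace ℝ V] : Type _ :=
  V × (V →L[ℝ] ℝ)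

/-- The model of the fibers of the stable big tangent bundle. -/
abbrev StableModel (V : Type*) [NormedAddCommGroup V] [NormedSpace ℝ V] (h : ℕ) : Type _ :=
  (V × RSpace h) × ((V →L[ℝ] ℝ) × RSpace h)

/-- A section of the big tangent bundle, read in the preferred chart at `x₀`. -/
def bigInChart (s : Π x : M, Big I x) (x₀ : M) (z : E) : BigModel E :=
  (vectorFieldInChart I (fun x => (s x).1) x₀ z, oneFormInChart I (fun x => (s x).2) x₀ z)

/-- A section of the stable big tangent bundle, read in the preferred chart at `x₀`. -/
def stableInChart (s : Π x : M, StableBig I h x) (x₀ : M) (z : E) : StableModel E h :=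
  ((vectorFieldInChart I (fun x => (s x).1.1) x₀ z, (s ((extChartAt I x₀).symm z)).1.2),
    (oneFormInChart I (fun x => (s x).2.1) x₀ z, (s ((extChartAt I x₀).symm z)).2.2))

variable [IsManifold I ∞ M]

lemma stableInChart_self (s : Π x : M, StableBig I h x) (x : M) :
    stableInChart I h s x (extChartAt I x x) = s x := by
  refine Prod.ext (Prod.ext (vectorFieldInChart_self I (fun x => (s x).1.1) x) ?_)
    (Prod.ext (oneFormInChart_self I (fun x => (s x).2.1) x) ?_)
  · exact congrArg (fun y => (s y).1.2) (extChartAt_to_inv x)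
  · exact congrArg (fun y => (s y).2.2) (extChartAt_to_inv x)

variable [I.Boundaryless]

lemma smoothBigOn_iff {s : Π x : M, Big I x} {U : Set M} (hU : IsOpen U) :
    SmoothBigOn I s U ↔
      ∀ x ∈ U, ContDiffAt ℝ ∞ (bigInChart I s x) (extChartAt I x x) := by
  constructor
  · rintro ⟨h₁, h₂⟩ x hx
    exact ((contMDiffAt_vectorField_iff I).1 (h₁.contMDiffAt (hU.mem_nhds hx))).prodMk
      ((contMDiffAt_oneForm_iff I).1 (h₂.contMDiffAt (hU.mem_nhds hx)))
  · intro hs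
    exact ⟨fun x hx => ((contMDiffAt_vectorField_iff I (X := fun x => (s x).1)).2
        (hs x hx).fst).contMDiffWithinAt,
      fun x hx => ((contMDiffAt_oneForm_iff I (α := fun x => (s x).2)).2
        (hs x hx).snd).contMDiffWithinAt⟩

lemma smoothStableOn_iff {s : Π x : M, StableBig I h x} {U : Set M} (hU : IsOpen U) :
    SmoothStableOn I h s U ↔
      ∀ x ∈ U, ContDiffAt ℝ ∞ (stableInChart I h s x) (extChartAt I x x) := by
  constructor
  · rintro ⟨h₁, h₂, h₃, h₄⟩ x hx
    have hn := hU.mem_nhds hx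
    exact (((contMDiffAt_vectorField_iff I).1 (h₁.contMDiffAt hn)).prodMk
      ((contMDiffAt_iff_contDiffAt_chart I).1 (h₂.contMDiffAt hn))).prodMk
      (((contMDiffAt_oneForm_iff I).1 (h₃.contMDiffAt hn)).prodMk
      ((contMDiffAt_iff_contDiffAt_chart I).1 (h₄.contMDiffAt hn)))
  · intro hs
    exact ⟨fun x hx => ((contMDiffAt_vectorField_iff I (X := fun x => (s x).1.1)).2
        (hs x hx).fst.fst).contMDiffWithinAt,
      fun x hx =>
        ((contMDiffAt_iff_contDiffAt_chart I).2 (hs x hx).fst.snd).contMDiffWithinAt,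
      fun x hx => ((contMDiffAt_oneForm_iff I (α := fun x => (s x).2.1)).2
        (hs x hx).snd.fst).contMDiffWithinAt,
      fun x hx =>
        ((contMDiffAt_iff_contDiffAt_chart I).2 (hs x hx).snd.snd).contMDiffWithinAt⟩

omit [IsManifold I ∞ M] [I.Boundaryless] in
lemma fderiv_bigInChart {s : Π x : M, Big I x} {x : M}
    (hs : ContDiffAt ℝ ∞ (bigInChart I s x) (extChartAt I x x)) (v : E) :
    fderiv ℝ (bigInChart I s x) (extChartAt I x x) v
      = (fderiv ℝ (vectorFieldInChart I (fun x => (s x).1) x) (extChartAt I x x) v,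
        fderiv ℝ (oneFormInChart I (fun x => (s x).2) x) (extChartAt I x x) v) := by
  have h₁ : ContDiffAt ℝ ∞ (vectorFieldInChart I (fun x => (s x).1) x) (extChartAt I x x) :=
    hs.fst
  have h₂ : ContDiffAt ℝ ∞ (oneFormInChart I (fun x => (s x).2) x) (extChartAt I x x) :=
    hs.snd
  exact congrArg (fun L => L v) ((h₁.differentiableAt (by simp)).hasFDerivAt.prodMk
    (h₂.differentiableAt (by simp)).hasFDerivAt).fderiv

omit [IsManifold I ∞ M] [I.Boundaryless] in
lemma fderiv_stableInChart {s : Π x : M, StableBig I h x} {x : M}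
    (hs : ContDiffAt ℝ ∞ (stableInChart I h s x) (extChartAt I x x)) (v : E) :
    fderiv ℝ (stableInChart I h s x) (extChartAt I x x) v
      = ((fderiv ℝ (vectorFieldInChart I (fun x => (s x).1.1) x) (extChartAt I x x) v,
          fderiv ℝ (fun z => (s ((extChartAt I x).symm z)).1.2) (extChartAt I x x) v),
        (fderiv ℝ (oneFormInChart I (fun x => (s x).2.1) x) (extChartAt I x x) v,
          fderiv ℝ (fun z => (s ((extChartAt I x).symm z)).2.2) (extChartAt I x x) v)) := by
  have h₁ : ContDiffAt ℝ ∞ (vectorFieldInChart I (fun x => (s x).1.1) x) (extChartAt I x x) :=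
    hs.fst.fst
  have h₂ : ContDiffAt ℝ ∞ (fun z => (s ((extChartAt I x).symm z)).1.2) (extChartAt I x x) :=
    hs.fst.snd
  have h₃ : ContDiffAt ℝ ∞ (oneFormInChart I (fun x => (s x).2.1) x) (extChartAt I x x) :=
    hs.snd.fst
  have h₄ : ContDiffAt ℝ ∞ (fun z => (s ((extChartAt I x).symm z)).2.2) (extChartAt I x x) :=
    hs.snd.snd
  exact congrArg (fun L => L v) (((h₁.differentiableAt (by simp)).hasFDerivAt.prodMk
    (h₂.differentiableAt (by simp)).hasFDerivAt).prodMk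
    ((h₃.differentiableAt (by simp)).hasFDerivAt.prodMk
    (h₄.differentiableAt (by simp)).hasFDerivAt)).fderiv

/-- The neutral metric of the model of the big tangent bundle. -/
def bigModelMetric {V : Type*} [NormedAddCommGroup V] [NormedSpace ℝ V] (a b : BigModel V) : ℝ :=
  (1 / 2) * (b.2 a.1 + a.2 b.1)

/-- The neutral metric of the model of the stable big tangent bundle. -/
def stableModelMetric {V : Type*} [NormedAddCommGroup V] [NormedSpace ℝ V] {h : ℕ}
    (a b : StableModel V h) : ℝ :=
  (1 / 2) * (b.2.1 a.1.1 + a.2.1 b.1.1 + inner ℝ a.1.2 b.2.2 + inner ℝ b.1.2 a.2.2)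

/-- The vector part of the Courant bracket, in terms of values and first derivatives in a chart. -/
lemma courantBracket_fst {s₁ s₂ : Π x : M, Big I x} {x : M}
    (h₁ : ContDiffAt ℝ ∞ (bigInChart I s₁ x) (extChartAt I x x))
    (h₂ : ContDiffAt ℝ ∞ (bigInChart I s₂ x) (extChartAt I x x)) :
    (courantBracket I s₁ s₂ x : BigModel E).1 =
      (fderiv ℝ (bigInChart I s₂ x) (extChartAt I x x)
          (bigInChart I s₁ x (extChartAt I x x)).1).1
        - (fderiv ℝ (bigInChart I s₁ x) (extChartAt I x x)
          (bigInChart I s₂ x (extChartAt I x x)).1).1 := by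
  rw [fderiv_bigInChart I h₁, fderiv_bigInChart I h₂]
  exact mlieBracket_eq_chart I (fun y => (s₁ y).1) (fun y => (s₂ y).1) x

/-- The covector part of the Courant bracket, in terms of values and first derivatives in a
chart. -/
lemma courantBracket_snd {s₁ s₂ : Π x : M, Big I x} {x : M}
    (h₁ : ContDiffAt ℝ ∞ (bigInChart I s₁ x) (extChartAt I x x))
    (h₂ : ContDiffAt ℝ ∞ (bigInChart I s₂ x) (extChartAt I x x)) (y : E) :
    (courantBracket I s₁ s₂ x : BigModel E).2 y =
      (fderiv ℝ (bigInChart I s₂ x) (extChartAt I x x)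
          (bigInChart I s₁ x (extChartAt I x x)).1).2 y
        - (fderiv ℝ (bigInChart I s₁ x) (extChartAt I x x)
          (bigInChart I s₂ x (extChartAt I x x)).1).2 y
        + bigModelMetric (fderiv ℝ (bigInChart I s₁ x) (extChartAt I x x) y)
          (bigInChart I s₂ x (extChartAt I x x))
        - bigModelMetric (fderiv ℝ (bigInChart I s₂ x) (extChartAt I x x) y)
          (bigInChart I s₁ x (extChartAt I x x)) := by
  have e₁ := lieOneForm_eq_chart (X := fun y => (s₁ y).1) (α := fun y => (s₂ y).2) h₁.fst h₂.snd y
  have e₂ := lieOneForm_eq_chart (X := fun y => (s₂ y).1) (α := fun y => (s₁ y).2) h₂.fst h₁.snd y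
  have d₁ := dFun_contraction (X := fun y => (s₁ y).1) (α := fun y => (s₂ y).2) h₁.fst h₂.snd y
  have d₂ := dFun_contraction (X := fun y => (s₂ y).1) (α := fun y => (s₁ y).2) h₂.fst h₁.snd y
  have m₁ := (contMDiffAt_contraction (X := fun y => (s₁ y).1) (α := fun y => (s₂ y).2)
    h₁.fst h₂.snd).mdifferentiableAt (by simp)
  have m₂ := (contMDiffAt_contraction (X := fun y => (s₂ y).1) (α := fun y => (s₁ y).2)
    h₂.fst h₁.snd).mdifferentiableAt (by simp)
  have e₃ : (dFun I (fun y => bigOmega I y (s₁ y) (s₂ y)) x : E →L[ℝ] ℝ) y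
      = (1 / 2) * ((dFun I (fun y => (s₂ y).2 (s₁ y).1) x : E →L[ℝ] ℝ) y
        - (dFun I (fun y => (s₁ y).2 (s₂ y).1) x : E →L[ℝ] ℝ) y) :=
    congrArg (fun L : E →L[ℝ] ℝ => L y)
      ((m₁.hasMFDerivAt.sub m₂.hasMFDerivAt).const_smul (1 / 2 : ℝ)).mfderiv
  have e₄ : (courantBracket I s₁ s₂ x : BigModel E).2 y
      = (lieOneForm I (fun y => (s₁ y).1) (fun y => (s₂ y).2) x : E →L[ℝ] ℝ) y
      - (lieOneForm I (fun y => (s₂ y).1) (fun y => (s₁ y).2) x : E →L[ℝ] ℝ) y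
      - (dFun I (fun y => bigOmega I y (s₁ y) (s₂ y)) x : E →L[ℝ] ℝ) y := rfl
  rw [e₄, e₁, e₂, e₃, d₁, d₂]
  simp only [bigModelMetric, fderiv_bigInChart I h₁, fderiv_bigInChart I h₂]
  simp only [bigInChart]
  ring

variable {h}

omit [IsManifold I ∞ M] in
lemma along_eq_chart {X : Π x : M, TangentSpace I x} {v : M → RSpace h} {x : M}
    (hv : ContDiffAt ℝ ∞ (fun z => v ((extChartAt I x).symm z)) (extChartAt I x x)) :
    along I X v x = fderiv ℝ (fun z => v ((extChartAt I x).symm z)) (extChartAt I x x) (X x) := by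
  have h₁ := mfderiv_eq_fderiv_chart I ((contMDiffAt_iff_contDiffAt_chart I).2 hv)
  exact congrArg (fun L : E →L[ℝ] RSpace h => L (X x)) h₁

omit [IsManifold I ∞ M] in
lemma dotD_eq_chart {u v : M → RSpace h} {x : M}
    (hv : ContDiffAt ℝ ∞ (fun z => v ((extChartAt I x).symm z)) (extChartAt I x x)) (y : E) :
    (dotD I u v x : E →L[ℝ] ℝ) y
      = inner ℝ (u ((extChartAt I x).symm (extChartAt I x x)))
        (fderiv ℝ (fun z => v ((extChartAt I x).symm z)) (extChartAt I x x) y) := by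
  have hd (a : Fin h) : (dFun I (fun y => v y a) x : E →L[ℝ] ℝ) y
      = fderiv ℝ (fun z => v ((extChartAt I x).symm z)) (extChartAt I x x) y a := by
    have h₁ : ContDiffAt ℝ ∞ (fun z => v ((extChartAt I x).symm z) a) (extChartAt I x x) :=
      contDiffAt_euclidean.1 hv a
    have h₂ := mfderiv_eq_fderiv_chart I ((contMDiffAt_iff_contDiffAt_chart I
      (f := fun y => v y a)).2 h₁)
    have h₃ := ((EuclideanSpace.proj (𝕜 := ℝ) a : RSpace h →L[ℝ] ℝ).hasFDerivAt.comp
      (extChartAt I x x) (hv.differentiableAt (by simp)).hasFDerivAt).fderiv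
    exact congrArg (fun L : E →L[ℝ] ℝ => L y) (h₂.trans h₃)
  have hs : (dotD I u v x : E →L[ℝ] ℝ) y
      = ∑ a, u x a * (dFun I (fun y => v y a) x : E →L[ℝ] ℝ) y :=
    sum_apply (F := E →L[ℝ] ℝ) Finset.univ (fun a : Fin h => u x a • dFun I (fun y => v y a) x) y
  rw [hs, PiLp.inner_apply, extChartAt_to_inv]
  refine Finset.sum_congr rfl fun a _ => ?_
  rw [hd a]
  simp [mul_comm]

variable (h)

lemma wadeBracket_X {τ : RSpace h → ℝ} {s₁ s₂ : Π x : M, StableBig I h x} {x : M}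
    (h₁ : ContDiffAt ℝ ∞ (stableInChart I h s₁ x) (extChartAt I x x))
    (h₂ : ContDiffAt ℝ ∞ (stableInChart I h s₂ x) (extChartAt I x x)) :
    (wadeBracket I h τ s₁ s₂ x : StableModel E h).1.1 =
      (fderiv ℝ (stableInChart I h s₂ x) (extChartAt I x x)
          (stableInChart I h s₁ x (extChartAt I x x)).1.1).1.1
        - (fderiv ℝ (stableInChart I h s₁ x) (extChartAt I x x)
          (stableInChart I h s₂ x (extChartAt I x x)).1.1).1.1 := by
  rw [fderiv_stableInChart I h h₁, fderiv_stableInChart I h h₂]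
  exact mlieBracket_eq_chart I (fun y => (s₁ y).1.1) (fun y => (s₂ y).1.1) x

lemma wadeBracket_u {τ : RSpace h → ℝ} {s₁ s₂ : Π x : M, StableBig I h x} {x : M}
    (h₁ : ContDiffAt ℝ ∞ (stableInChart I h s₁ x) (extChartAt I x x))
    (h₂ : ContDiffAt ℝ ∞ (stableInChart I h s₂ x) (extChartAt I x x)) :
    (wadeBracket I h τ s₁ s₂ x : StableModel E h).1.2 =
      (fderiv ℝ (stableInChart I h s₂ x) (extChartAt I x x)
          (stableInChart I h s₁ x (extChartAt I x x)).1.1).1.2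
        - (fderiv ℝ (stableInChart I h s₁ x) (extChartAt I x x)
          (stableInChart I h s₂ x (extChartAt I x x)).1.1).1.2 := by
  rw [fderiv_stableInChart I h h₁, fderiv_stableInChart I h h₂, stableInChart_self,
    stableInChart_self]
  exact congrArg₂ (· - ·) (along_eq_chart I (X := fun y => (s₁ y).1.1)
      (v := fun y => (s₂ y).1.2) h₂.fst.snd)
    (along_eq_chart I (X := fun y => (s₂ y).1.1) (v := fun y => (s₁ y).1.2) h₁.fst.snd)

lemma wadeBracket_α {τ : RSpace h → ℝ} {s₁ s₂ : Π x : M, StableBig I h x} {x : M}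
    (h₁ : ContDiffAt ℝ ∞ (stableInChart I h s₁ x) (extChartAt I x x))
    (h₂ : ContDiffAt ℝ ∞ (stableInChart I h s₂ x) (extChartAt I x x)) (y : E) :
    (wadeBracket I h τ s₁ s₂ x : StableModel E h).2.1 y =
      (fderiv ℝ (stableInChart I h s₂ x) (extChartAt I x x)
          (stableInChart I h s₁ x (extChartAt I x x)).1.1).2.1 y
        - (fderiv ℝ (stableInChart I h s₁ x) (extChartAt I x x)
          (stableInChart I h s₂ x (extChartAt I x x)).1.1).2.1 y
        + stableModelMetric (fderiv ℝ (stableInChart I h s₁ x) (extChartAt I x x) y)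
          (stableInChart I h s₂ x (extChartAt I x x))
        - stableModelMetric (fderiv ℝ (stableInChart I h s₂ x) (extChartAt I x x) y)
          (stableInChart I h s₁ x (extChartAt I x x))
        + fderiv ℝ τ 0 (stableInChart I h s₁ x (extChartAt I x x)).1.2
          * (stableInChart I h s₂ x (extChartAt I x x)).2.1 y
        - fderiv ℝ τ 0 (stableInChart I h s₂ x (extChartAt I x x)).1.2
          * (stableInChart I h s₁ x (extChartAt I x x)).2.1 y := by
  have e₁ := lieOneForm_eq_chart (X := fun y => (s₁ y).1.1) (α := fun y => (s₂ y).2.1)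
    h₁.fst.fst h₂.snd.fst y
  have e₂ := lieOneForm_eq_chart (X := fun y => (s₂ y).1.1) (α := fun y => (s₁ y).2.1)
    h₂.fst.fst h₁.snd.fst y
  have d₁ := dFun_contraction (X := fun y => (s₁ y).1.1) (α := fun y => (s₂ y).2.1)
    h₁.fst.fst h₂.snd.fst y
  have d₂ := dFun_contraction (X := fun y => (s₂ y).1.1) (α := fun y => (s₁ y).2.1)
    h₂.fst.fst h₁.snd.fst y
  have m₁ := (contMDiffAt_contraction (X := fun y => (s₁ y).1.1) (α := fun y => (s₂ y).2.1)
    h₁.fst.fst h₂.snd.fst).mdifferentiableAt (by simp)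
  have m₂ := (contMDiffAt_contraction (X := fun y => (s₂ y).1.1) (α := fun y => (s₁ y).2.1)
    h₂.fst.fst h₁.snd.fst).mdifferentiableAt (by simp)
  have e₃ : (dFun I (fun y => (s₁ y).2.1 (s₂ y).1.1 - (s₂ y).2.1 (s₁ y).1.1) x : E →L[ℝ] ℝ) y
      = (dFun I (fun y => (s₁ y).2.1 (s₂ y).1.1) x : E →L[ℝ] ℝ) y
        - (dFun I (fun y => (s₂ y).2.1 (s₁ y).1.1) x : E →L[ℝ] ℝ) y :=
    congrArg (fun L : E →L[ℝ] ℝ => L y) (m₂.hasMFDerivAt.sub m₁.hasMFDerivAt).mfderiv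
  have f₁ := dotD_eq_chart I (u := fun y => (s₂ y).1.2) (v := fun y => (s₁ y).2.2)
    h₁.snd.snd y
  have f₂ := dotD_eq_chart I (u := fun y => (s₂ y).2.2) (v := fun y => (s₁ y).1.2)
    h₁.fst.snd y
  have f₃ := dotD_eq_chart I (u := fun y => (s₁ y).1.2) (v := fun y => (s₂ y).2.2)
    h₂.snd.snd y
  have f₄ := dotD_eq_chart I (u := fun y => (s₁ y).2.2) (v := fun y => (s₂ y).1.2)
    h₂.fst.snd y
  have e₄ : (wadeBracket I h τ s₁ s₂ x : StableModel E h).2.1 y =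
      (lieOneForm I (fun y => (s₁ y).1.1) (fun y => (s₂ y).2.1) x : E →L[ℝ] ℝ) y
      - (lieOneForm I (fun y => (s₂ y).1.1) (fun y => (s₁ y).2.1) x : E →L[ℝ] ℝ) y
      + (1 / 2) * (dFun I (fun y => (s₁ y).2.1 (s₂ y).1.1 - (s₂ y).2.1 (s₁ y).1.1) x :
        E →L[ℝ] ℝ) y
      + fderiv ℝ τ 0 (s₁ ((extChartAt I x).symm (extChartAt I x x))).1.2
        * (oneFormInChart I (fun x => (s₂ x).2.1) x (extChartAt I x x)) y
      - fderiv ℝ τ 0 (s₂ ((extChartAt I x).symm (extChartAt I x x))).1.2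
        * (oneFormInChart I (fun x => (s₁ x).2.1) x (extChartAt I x x)) y
      + (1 / 2) * ((dotD I (fun y => (s₂ y).1.2) (fun y => (s₁ y).2.2) x : E →L[ℝ] ℝ) y
        + (dotD I (fun y => (s₂ y).2.2) (fun y => (s₁ y).1.2) x : E →L[ℝ] ℝ) y
        - (dotD I (fun y => (s₁ y).1.2) (fun y => (s₂ y).2.2) x : E →L[ℝ] ℝ) y
        - (dotD I (fun y => (s₁ y).2.2) (fun y => (s₂ y).1.2) x : E →L[ℝ] ℝ) y) := by
    rw [oneFormInChart_self, oneFormInChart_self, extChartAt_to_inv]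
    rfl
  rw [e₄, e₁, e₂, e₃, d₁, d₂, f₁, f₂, f₃, f₄]
  simp only [stableModelMetric, fderiv_stableInChart I h h₁, fderiv_stableInChart I h h₂]
  simp only [stableInChart]
  rw [real_inner_comm (s₁ ((extChartAt I x).symm (extChartAt I x x))).2.2,
    real_inner_comm (s₂ ((extChartAt I x).symm (extChartAt I x x))).2.2]
  ring

lemma wadeBracket_v {τ : RSpace h → ℝ} {s₁ s₂ : Π x : M, StableBig I h x} {x : M}
    (h₁ : ContDiffAt ℝ ∞ (stableInChart I h s₁ x) (extChartAt I x x))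
    (h₂ : ContDiffAt ℝ ∞ (stableInChart I h s₂ x) (extChartAt I x x)) :
    (wadeBracket I h τ s₁ s₂ x : StableModel E h).2.2 =
      (fderiv ℝ (stableInChart I h s₂ x) (extChartAt I x x)
          (stableInChart I h s₁ x (extChartAt I x x)).1.1).2.2
        - (fderiv ℝ (stableInChart I h s₁ x) (extChartAt I x x)
          (stableInChart I h s₂ x (extChartAt I x x)).1.1).2.2
        + ((1 / 2) * ((stableInChart I h s₁ x (extChartAt I x x)).2.1
            (stableInChart I h s₂ x (extChartAt I x x)).1.1
          - (stableInChart I h s₂ x (extChartAt I x x)).2.1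
            (stableInChart I h s₁ x (extChartAt I x x)).1.1
          + inner ℝ (stableInChart I h s₂ x (extChartAt I x x)).1.2
            (stableInChart I h s₁ x (extChartAt I x x)).2.2
          - inner ℝ (stableInChart I h s₁ x (extChartAt I x x)).1.2
            (stableInChart I h s₂ x (extChartAt I x x)).2.2)) • gradient τ 0
        + fderiv ℝ τ 0 (stableInChart I h s₁ x (extChartAt I x x)).1.2
          • (stableInChart I h s₂ x (extChartAt I x x)).2.2
        - fderiv ℝ τ 0 (stableInChart I h s₂ x (extChartAt I x x)).1.2
          • (stableInChart I h s₁ x (extChartAt I x x)).2.2 := by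
  rw [fderiv_stableInChart I h h₁, fderiv_stableInChart I h h₂, stableInChart_self,
    stableInChart_self]
  have e₁ := along_eq_chart I (X := fun y => (s₁ y).1.1) (v := fun y => (s₂ y).2.2)
    h₂.snd.snd
  have e₂ := along_eq_chart I (X := fun y => (s₂ y).1.1) (v := fun y => (s₁ y).2.2)
    h₁.snd.snd
  simp only [wadeBracket]
  refine congrArg₂ (· - ·) (congrArg₂ (· + ·) (congrArg₂ (· + ·)
    (congrArg₂ (· - ·) e₁ e₂) rfl) rfl) rfl

end Jets

noncomputable section Product

variable {E : Type*} [NormedAddCommGroup E] [NormedSpace ℝ E]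
  {H : Type*} [TopologicalSpace H] (I : ModelWithCorners ℝ E H) (h : ℕ)
  {M : Type*} [TopologicalSpace M] [ChartedSpace H M]

/-- The identification of the models of the stable big tangent bundle of `M` and of the big
tangent bundle of `M × ℝ^h`. -/
def modelLift (E : Type*) [NormedAddCommGroup E] [NormedSpace ℝ E] [FiniteDimensional ℝ E]
    (h : ℕ) : StableModel E h ≃L[ℝ] BigModel (E × RSpace h) :=
  LinearEquiv.toContinuousLinearEquiv
    { toFun := fun e => ((e.1.1, e.1.2), e.2.1.coprod (innerSL ℝ e.2.2))
      invFun := fun b => (b.1, (b.2.comp (ContinuousLinearMap.inl ℝ E (RSpace h)),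
        (InnerProductSpace.toDual ℝ (RSpace h)).symm
          (b.2.comp (ContinuousLinearMap.inr ℝ E (RSpace h)))))
      map_add' := fun a b => by
        refine Prod.ext rfl (ContinuousLinearMap.ext fun y => ?_)
        simp
      map_smul' := fun r a => by
        refine Prod.ext rfl (ContinuousLinearMap.ext fun y => ?_)
        simp
        ring
      left_inv := fun e => by
        refine Prod.ext rfl (Prod.ext (ContinuousLinearMap.ext fun y => by simp) ?_)
        refine ext_inner_right ℝ fun w => ?_
        simp
      right_inv := fun b => by
        refine Prod.ext rfl (ContinuousLinearMap.ext fun y => ?_)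
        simp [← map_add] }

lemma modelLift_apply [FiniteDimensional ℝ E] (e : StableModel E h) :
    modelLift E h e = ((e.1.1, e.1.2), e.2.1.coprod (innerSL ℝ e.2.2)) := rfl

/-- The conformal change by the factor `exp σ` on the model of the big tangent bundle. -/
def modelTwist {V : Type*} [NormedAddCommGroup V] [NormedSpace ℝ V] (σ : ℝ) (b : BigModel V) :
    BigModel V :=
  (b.1, Real.exp σ • b.2)

/-- The section of the big tangent bundle of `M × ℝ^h` that the family `s` of sections of the
stable big tangent bundle, parametrized by `ℝ^h`, induces after the conformal change by `τ`. -/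
def conformalLift (τ : RSpace h → ℝ) (s : RSpace h → Π x : M, StableBig I h x)
    (p : M × RSpace h) : Big (I.prod 𝓘(ℝ, RSpace h)) p :=
  conformalMap (I.prod 𝓘(ℝ, RSpace h)) (fun p => τ p.2) p (invariantLift I h p (s p.2 p.1))

variable [IsManifold I ∞ M] [I.Boundaryless]

lemma mfderivWithin_extChartAt_symm_prod (p : M × RSpace h) {z : E}
    (hz : z ∈ (extChartAt I p.1).target) (t : RSpace h) (y : E × RSpace h) :
    (mfderivWithin 𝓘(ℝ, E × RSpace h) (I.prod 𝓘(ℝ, RSpace h))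
        (extChartAt (I.prod 𝓘(ℝ, RSpace h)) p).symm (range (I.prod 𝓘(ℝ, RSpace h))) (z, t) :
        E × RSpace h →L[ℝ] E × RSpace h) y
      = ((mfderivWithin 𝓘(ℝ, E) I (extChartAt I p.1).symm (range I) z : E →L[ℝ] E) y.1, y.2) := by
  have : IsManifold I 1 M := .of_le (n := ∞) (by simp)
  have hf := (mdifferentiableWithinAt_extChartAt_symm (I := I) hz)
  rw [I.range_eq_univ] at hf ⊢
  rw [(I.prod 𝓘(ℝ, RSpace h)).range_eq_univ]
  have h₁ := hf.hasMFDerivWithinAt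
  rw [hasMFDerivWithinAt_univ] at h₁
  have e₁ : HasMFDerivAt 𝓘(ℝ, E × RSpace h) 𝓘(ℝ, E) (Prod.fst : E × RSpace h → E) (z, t)
      (ContinuousLinearMap.fst ℝ E (RSpace h)) :=
    (ContinuousLinearMap.fst ℝ E (RSpace h)).hasMFDerivAt
  have e₂ : HasMFDerivAt 𝓘(ℝ, E × RSpace h) 𝓘(ℝ, RSpace h)
      (Prod.snd : E × RSpace h → RSpace h) (z, t) (ContinuousLinearMap.snd ℝ E (RSpace h)) :=
    (ContinuousLinearMap.snd ℝ E (RSpace h)).hasMFDerivAt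
  have e₃ := (HasMFDerivAt.comp (z, t) (g := (extChartAt I p.1).symm) h₁ e₁).prodMk e₂
  have e₄ : ((extChartAt (I.prod 𝓘(ℝ, RSpace h)) p).symm : E × RSpace h → M × RSpace h)
      = fun q => (((extChartAt I p.1).symm ∘ Prod.fst) q, q.2) := by
    rw [extChartAt_prod]
    rfl
  rw [e₄, mfderivWithin_univ]
  exact congrArg (fun L : E × RSpace h →L[ℝ] E × RSpace h => L y) e₃.mfderiv

variable {h}

lemma bigInChart_conformalLift [FiniteDimensional ℝ E] (τ : RSpace h → ℝ)
    (s : RSpace h → Π x : M, StableBig I h x)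
    (p : M × RSpace h) {z : E} (hz : z ∈ (extChartAt I p.1).target) (t : RSpace h) :
    bigInChart (I.prod 𝓘(ℝ, RSpace h)) (conformalLift I h τ s) p (z, t)
      = modelTwist (τ t) (modelLift E h (stableInChart I h (s t) p.1 z)) := by
  have i₁ : IsManifold I 1 M := .of_le (n := ∞) (by simp)
  have i₂ : IsManifold (I.prod 𝓘(ℝ, RSpace h)) 1 (M × RSpace h) := .of_le (n := ∞) (by simp)
  have hzt : (z, t) ∈ (extChartAt (I.prod 𝓘(ℝ, RSpace h)) p).target := by
    rw [extChartAt_prod]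
    exact ⟨hz, by simp only [extChartAt_model_space_eq_id]; exact mem_univ _⟩
  have e₄ : (extChartAt (I.prod 𝓘(ℝ, RSpace h)) p).symm (z, t)
      = ((extChartAt I p.1).symm z, t) := by
    rw [extChartAt_prod]
    rfl
  have hD := mfderivWithin_extChartAt_symm_prod I h p hz t
  have hinv := isInvertible_mfderivWithin_extChartAt_symm hzt
  have hinv' := isInvertible_mfderivWithin_extChartAt_symm hz
  refine Prod.ext ?_ (ContinuousLinearMap.ext fun y => ?_)
  · have k := (hinv'.inverse_apply_eq (y := ((s t ((extChartAt I p.1).symm z)).1.1))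
      (x := mpullbackWithin 𝓘(ℝ, E) I (extChartAt I p.1).symm (fun x => (s t x).1.1) (range I)
        z)).1 rfl
    refine hinv.inverse_apply_eq.2 ?_
    refine Eq.trans ?_ (hD _).symm
    rw [e₄]
    exact Prod.ext k rfl
  · have k : (bigInChart (I.prod 𝓘(ℝ, RSpace h)) (conformalLift I h τ s) p (z, t)).2 y
        = ((conformalLift I h τ s ((extChartAt (I.prod 𝓘(ℝ, RSpace h)) p).symm (z, t)) :
          BigModel (E × RSpace h)).2) ((mfderivWithin 𝓘(ℝ, E × RSpace h) (I.prod 𝓘(ℝ, RSpace h))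
        (extChartAt (I.prod 𝓘(ℝ, RSpace h)) p).symm (range (I.prod 𝓘(ℝ, RSpace h))) (z, t) :
        E × RSpace h →L[ℝ] E × RSpace h) y) := rfl
    rw [k, hD, e₄]
    rfl

end Product

noncomputable section Lift

variable {E : Type*} [NormedAddCommGroup E] [NormedSpace ℝ E] [FiniteDimensional ℝ E]
  {H : Type*} [TopologicalSpace H] (I : ModelWithCorners ℝ E H) {h : ℕ}
  {M : Type*} [TopologicalSpace M] [ChartedSpace H M]

lemma linearFun_eq_inner (c : Fin h → ℝ) :
    linearFun c = fun t : RSpace h => inner ℝ (WithLp.toLp 2 c) t := by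
  funext t
  simp [linearFun, PiLp.inner_apply, mul_comm]

lemma hasFDerivAt_linearFun (c : Fin h → ℝ) (t : RSpace h) :
    HasFDerivAt (linearFun c) (innerSL ℝ (WithLp.toLp 2 c : RSpace h)) t := by
  rw [linearFun_eq_inner]
  exact (innerSL ℝ (WithLp.toLp 2 c : RSpace h)).hasFDerivAt

lemma gradient_linearFun (c : Fin h → ℝ) (t : RSpace h) :
    gradient (linearFun c) t = WithLp.toLp 2 c := by
  refine HasGradientAt.gradient ?_
  rw [hasGradientAt_iff_hasFDerivAt]
  exact hasFDerivAt_linearFun c t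

lemma contDiff_linearFun (c : Fin h → ℝ) : ContDiff ℝ ∞ (linearFun (h := h) c) := by
  rw [linearFun_eq_inner]
  exact (innerSL ℝ (WithLp.toLp 2 c : RSpace h)).contDiff

lemma modelTwist_neg_modelTwist {V : Type*} [NormedAddCommGroup V] [NormedSpace ℝ V] (σ : ℝ)
    (b : BigModel V) : modelTwist (-σ) (modelTwist σ b) = b := by
  simp [modelTwist, smul_smul, ← Real.exp_add]

lemma _root_.ContDiffAt.modelTwist {V W : Type*} [NormedAddCommGroup V] [NormedSpace ℝ V]
    [NormedAddCommGroup W] [NormedSpace ℝ W] {σ : W → ℝ} {f : W → BigModel V} {w : W}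
    (hσ : ContDiffAt ℝ ∞ σ w) (hf : ContDiffAt ℝ ∞ f w) :
    ContDiffAt ℝ ∞ (fun w => modelTwist (σ w) (f w)) w :=
  hf.fst.prodMk (hσ.exp.smul hf.snd)

variable [IsManifold I ∞ M] [I.Boundaryless]

lemma bigInChart_conformalLift_eventuallyEq (c : Fin h → ℝ)
    (s : RSpace h → Π x : M, StableBig I h x) (x : M) (t : RSpace h) :
    bigInChart (I.prod 𝓘(ℝ, RSpace h)) (conformalLift I h (linearFun c) s) (x, t)
      =ᶠ[𝓝 (extChartAt I x x, t)] fun q : E × RSpace h =>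
        modelTwist (linearFun c q.2) (modelLift E h (stableInChart I h (s q.2) x q.1)) := by
  filter_upwards [continuous_fst.continuousAt.preimage_mem_nhds
    ((isOpen_extChartAt_target x).mem_nhds (mem_extChartAt_target x))] with q hq
  exact bigInChart_conformalLift I (linearFun c) s (x, t) hq q.2

omit [FiniteDimensional ℝ E] [IsManifold I ∞ M] [I.Boundaryless] in
lemma extChartAt_prod_apply_self (x : M) (t : RSpace h) :
    extChartAt (I.prod 𝓘(ℝ, RSpace h)) (x, t) (x, t) = (extChartAt I x x, t) := by
  rw [extChartAt_prod]
  rfl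

/-- A family of sections of the stable big tangent bundle is smooth if and only if the
corresponding section of the big tangent bundle of `M × ℝ^h` is. -/
lemma contDiffAt_conformalLift_iff (c : Fin h → ℝ)
    (s : RSpace h → Π x : M, StableBig I h x) (x : M) (t : RSpace h) :
    ContDiffAt ℝ ∞ (bigInChart (I.prod 𝓘(ℝ, RSpace h)) (conformalLift I h (linearFun c) s) (x, t))
        (extChartAt (I.prod 𝓘(ℝ, RSpace h)) (x, t) (x, t)) ↔
      ContDiffAt ℝ ∞ (fun q : E × RSpace h => stableInChart I h (s q.2) x q.1)
        (extChartAt I x x, t) := by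
  rw [extChartAt_prod_apply_self]
  have he := bigInChart_conformalLift_eventuallyEq I c s x t
  have hτ : ContDiffAt ℝ ∞ (fun q : E × RSpace h => linearFun c q.2) (extChartAt I x x, t) :=
    ((contDiff_linearFun c).comp contDiff_snd).contDiffAt
  constructor
  · intro hs
    have h₁ := (modelLift E h).symm.contDiff.contDiffAt.comp (extChartAt I x x, t)
      (hτ.neg.modelTwist (hs.congr_of_eventuallyEq he.symm))
    refine h₁.congr_of_eventuallyEq (Filter.Eventually.of_forall fun q => ?_)
    simp [modelTwist_neg_modelTwist]
  · intro hs
    exact (hτ.modelTwist ((modelLift E h).contDiff.contDiffAt.comp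
      (extChartAt I x x, t) hs)).congr_of_eventuallyEq he

/-- The derivative of a family of sections at a fixed point of `M`, in the direction of the
parameter. -/
def paramDeriv (s : RSpace h → Π x : M, StableBig I h x) (x : M) (t : RSpace h) :
    RSpace h →L[ℝ] StableModel E h :=
  fderiv ℝ (fun t => (s t x : StableModel E h)) t

omit [FiniteDimensional ℝ E] [I.Boundaryless] in
lemma fderiv_family {s : RSpace h → Π x : M, StableBig I h x} {x : M} {t : RSpace h}
    (hs : ContDiffAt ℝ ∞ (fun q : E × RSpace h => stableInChart I h (s q.2) x q.1)
      (extChartAt I x x, t)) :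
    HasFDerivAt (fun q : E × RSpace h => stableInChart I h (s q.2) x q.1)
      ((fderiv ℝ (stableInChart I h (s t) x) (extChartAt I x x)).coprod (paramDeriv I s x t))
      (extChartAt I x x, t) := by
  have h₀ := (hs.differentiableAt (by simp)).hasFDerivAt
  set L := fderiv ℝ (fun q : E × RSpace h => stableInChart I h (s q.2) x q.1) (extChartAt I x x, t)
  have h₁ := (HasFDerivAt.comp (extChartAt I x x) h₀
    ((hasFDerivAt_id (𝕜 := ℝ) (extChartAt I x x)).prodMk
      (hasFDerivAt_const t (extChartAt I x x)))).fderiv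
  have h₂ := (HasFDerivAt.comp t h₀
    ((hasFDerivAt_const (𝕜 := ℝ) (extChartAt I x x) t).prodMk (hasFDerivAt_id t))).fderiv
  have e : (fun t => (s t x : StableModel E h))
      = (fun q : E × RSpace h => stableInChart I h (s q.2) x q.1)
        ∘ fun t => (extChartAt I x x, id t) := by
    funext t
    exact (stableInChart_self I h (s t) x).symm
  have hL : (fderiv ℝ (stableInChart I h (s t) x) (extChartAt I x x)).coprod (paramDeriv I s x t)
      = L := by
    refine ContinuousLinearMap.ext fun q => ?_
    have h₁' := congrArg (fun L : E →L[ℝ] StableModel E h => L q.1) h₁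
    have h₂' := congrArg (fun L : RSpace h →L[ℝ] StableModel E h => L q.2) h₂
    rw [paramDeriv, e, ContinuousLinearMap.coprod_apply]
    refine (congrArg₂ (· + ·) h₁' h₂').trans ?_
    simp [← map_add]
  rwa [hL]

lemma fderiv_conformalLift {c : Fin h → ℝ}
    {s : RSpace h → Π x : M, StableBig I h x} {x : M} {t : RSpace h}
    (hs : ContDiffAt ℝ ∞ (fun q : E × RSpace h => stableInChart I h (s q.2) x q.1)
      (extChartAt I x x, t)) (y : E × RSpace h) :
    fderiv ℝ (bigInChart (I.prod 𝓘(ℝ, RSpace h)) (conformalLift I h (linearFun c) s) (x, t))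
        (extChartAt I x x, t) y
      = modelTwist (linearFun c t)
          (modelLift E h (fderiv ℝ (stableInChart I h (s t) x) (extChartAt I x x) y.1
            + paramDeriv I s x t y.2))
        + (0, (Real.exp (linearFun c t) * inner ℝ (WithLp.toLp 2 c) y.2)
          • (modelLift E h (s t x)).2) := by
  have h₀ := (modelLift E h).hasFDerivAt.comp (extChartAt I x x, t) (fderiv_family I hs)
  have hτ : HasFDerivAt (fun q : E × RSpace h => linearFun c q.2)
      ((innerSL ℝ (WithLp.toLp 2 c : RSpace h)).comp (ContinuousLinearMap.snd ℝ E (RSpace h)))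
      (extChartAt I x x, t) :=
    HasFDerivAt.comp (g := linearFun c) (f := Prod.snd) (extChartAt I x x, t)
      (hasFDerivAt_linearFun c t) (ContinuousLinearMap.snd ℝ E (RSpace h)).hasFDerivAt
  have h₁ := h₀.fst.prodMk (hτ.exp.smul h₀.snd)
  rw [((bigInChart_conformalLift_eventuallyEq I c s x t).fderiv_eq).trans h₁.fderiv]
  refine Prod.ext ?_ (ContinuousLinearMap.ext fun w => ?_)
  · simp [modelTwist]
  · simp only [modelTwist, comp_apply, stableInChart_self]
    simp

end Lift

noncomputable section Bracket

variable {E : Type*} [NormedAddCommGroup E] [NormedSpace ℝ E] [FiniteDimensional ℝ E]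
  {H : Type*} [TopologicalSpace H] (I : ModelWithCorners ℝ E H) {h : ℕ}
  {M : Type*} [TopologicalSpace M] [ChartedSpace H M]

/-- The pointwise comparison of the Courant bracket and the Wade bracket: `W` and `C` are the
values of the brackets of sections with values `a`, `b` and derivatives `a'`, `b'` along `M` and
`q₁`, `q₂` along `ℝ^h`. -/
lemma eq_modelTwist_modelLift_of_brackets {σ : ℝ} {γ : RSpace h} {a b W : StableModel E h}
    {a' b' : E →L[ℝ] StableModel E h} {q₁ q₂ : RSpace h →L[ℝ] StableModel E h}
    {C : BigModel (E × RSpace h)} {A' B' : E × RSpace h →L[ℝ] BigModel (E × RSpace h)}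
    (hq₁ : ∀ w, stableModelMetric (q₁ w) b = 0) (hq₂ : ∀ w, stableModelMetric (q₂ w) a = 0)
    (hA : ∀ y, A' y = modelTwist σ (modelLift E h (a' y.1 + q₁ y.2))
      + (0, (Real.exp σ * inner ℝ γ y.2) • (modelLift E h a).2))
    (hB : ∀ y, B' y = modelTwist σ (modelLift E h (b' y.1 + q₂ y.2))
      + (0, (Real.exp σ * inner ℝ γ y.2) • (modelLift E h b).2))
    (hX : W.1.1 = (b' a.1.1).1.1 - (a' b.1.1).1.1)
    (hu : W.1.2 = (b' a.1.1).1.2 - (a' b.1.1).1.2)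
    (hα : ∀ y, W.2.1 y = (b' a.1.1).2.1 y - (a' b.1.1).2.1 y
      + stableModelMetric (a' y) b - stableModelMetric (b' y) a
      + inner ℝ γ a.1.2 * b.2.1 y - inner ℝ γ b.1.2 * a.2.1 y)
    (hv : W.2.2 = (b' a.1.1).2.2 - (a' b.1.1).2.2
      + ((1 / 2) * (a.2.1 b.1.1 - b.2.1 a.1.1 + inner ℝ b.1.2 a.2.2 - inner ℝ a.1.2 b.2.2)) • γ
      + (inner ℝ γ a.1.2 : ℝ) • b.2.2 - (inner ℝ γ b.1.2 : ℝ) • a.2.2)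
    (hC₁ : C.1 = (B' (modelTwist σ (modelLift E h a)).1).1
      - (A' (modelTwist σ (modelLift E h b)).1).1)
    (hC₂ : ∀ y, C.2 y = (B' (modelTwist σ (modelLift E h a)).1).2 y
      - (A' (modelTwist σ (modelLift E h b)).1).2 y
      + bigModelMetric (A' y) (modelTwist σ (modelLift E h b))
      - bigModelMetric (B' y) (modelTwist σ (modelLift E h a))) :
    C = modelTwist σ (modelLift E h (W + q₂ a.1.2 - q₁ b.1.2)) := by
  refine Prod.ext ?_ (ContinuousLinearMap.ext fun y => ?_)
  · rw [hC₁, hA, hB]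
    refine Prod.ext ?_ ?_
    · simp only [modelTwist, modelLift_apply, hX, Prod.fst_add, Prod.fst_sub, Prod.fst_zero]
      simp
      abel
    · simp only [modelTwist, modelLift_apply, hu, Prod.fst_add, Prod.fst_sub, Prod.snd_add,
        Prod.snd_sub]
      simp
      abel
  · have e₁ := hq₁ y.2
    have e₂ := hq₂ y.2
    rw [hC₂, hA, hB, hA, hB]
    simp only [modelTwist, modelLift_apply, bigModelMetric, stableModelMetric] at e₁ e₂ hα ⊢
    simp only [Prod.fst_add, Prod.snd_add, Prod.fst_sub, Prod.snd_sub, add_apply,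
      ContinuousLinearMap.coprod_apply, innerSL_apply_apply, smul_apply, sub_apply, hα, hv,
      inner_add_left, inner_sub_left, real_inner_smul_left, add_zero, map_add,
      smul_eq_mul]
    rw [real_inner_comm b.2.2, real_inner_comm b.2.2, real_inner_comm a.2.2,
      real_inner_comm a.2.2, real_inner_comm b.1.2 (a' y.1).2.2,
      real_inner_comm b.1.2 (q₁ y.2).2.2, real_inner_comm a.1.2 (b' y.1).2.2,
      real_inner_comm a.1.2 (q₂ y.2).2.2] at *
    linear_combination Real.exp σ * e₁ - Real.exp σ * e₂

variable [IsManifold I ∞ M] [I.Boundaryless]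

/-- The Courant bracket of the sections of the big tangent bundle of `M × ℝ^h` given by two
families of sections of the stable big tangent bundle. -/
lemma courantBracket_conformalLift {c : Fin h → ℝ}
    {s₁ s₂ : RSpace h → Π x : M, StableBig I h x} {x : M} {t : RSpace h}
    (h₁ : ContDiffAt ℝ ∞ (fun q : E × RSpace h => stableInChart I h (s₁ q.2) x q.1)
      (extChartAt I x x, t))
    (h₂ : ContDiffAt ℝ ∞ (fun q : E × RSpace h => stableInChart I h (s₂ q.2) x q.1)
      (extChartAt I x x, t))
    (hq₁ : ∀ w, stableModelMetric (paramDeriv I s₁ x t w) (s₂ t x) = 0)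
    (hq₂ : ∀ w, stableModelMetric (paramDeriv I s₂ x t w) (s₁ t x) = 0)
    {Q₁ Q₂ : StableBig I h x} (hQ₁ : paramDeriv I s₁ x t (s₂ t x).1.2 = Q₁)
    (hQ₂ : paramDeriv I s₂ x t (s₁ t x).1.2 = Q₂) :
    courantBracket (I.prod 𝓘(ℝ, RSpace h)) (conformalLift I h (linearFun c) s₁)
        (conformalLift I h (linearFun c) s₂) (x, t)
      = conformalMap (I.prod 𝓘(ℝ, RSpace h)) (fun p => linearFun c p.2) (x, t)
        (invariantLift I h (x, t) (wadeBracket I h (linearFun c) (s₁ t) (s₂ t) x + Q₂ - Q₁)) := by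
  have k₁ := (contDiffAt_conformalLift_iff I c s₁ x t).2 h₁
  have k₂ := (contDiffAt_conformalLift_iff I c s₂ x t).2 h₂
  have l₁ : ContDiffAt ℝ ∞ (stableInChart I h (s₁ t) x) (extChartAt I x x) :=
    h₁.comp (extChartAt I x x) (contDiffAt_id.prodMk contDiffAt_const)
  have l₂ : ContDiffAt ℝ ∞ (stableInChart I h (s₂ t) x) (extChartAt I x x) :=
    h₂.comp (extChartAt I x x) (contDiffAt_id.prodMk contDiffAt_const)
  have v₁ := (bigInChart_conformalLift_eventuallyEq I c s₁ x t).eq_of_nhds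
  have v₂ := (bigInChart_conformalLift_eventuallyEq I c s₂ x t).eq_of_nhds
  have c₁ := courantBracket_fst (I.prod 𝓘(ℝ, RSpace h)) k₁ k₂
  have c₂ := courantBracket_snd (I.prod 𝓘(ℝ, RSpace h)) k₁ k₂
  have wα := wadeBracket_α I h (τ := linearFun c) l₁ l₂
  have wv := wadeBracket_v I h (τ := linearFun c) l₁ l₂
  rw [(hasFDerivAt_linearFun c 0).fderiv] at wα wv
  rw [gradient_linearFun] at wv
  have r₁ := stableInChart_self I h (s₁ t) x
  have r₂ := stableInChart_self I h (s₂ t) x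
  have d₁ := fderiv_conformalLift I (c := c) h₁
  have d₂ := fderiv_conformalLift I (c := c) h₂
  rw [extChartAt_prod_apply_self] at c₁ c₂
  simp only [v₁, v₂] at c₁ c₂
  rw [← r₁] at d₁ hq₂
  rw [← r₂] at d₂ hq₁
  have key := eq_modelTwist_modelLift_of_brackets hq₁ hq₂ d₁ d₂
    (wadeBracket_X I h (τ := linearFun c) l₁ l₂) (wadeBracket_u I h (τ := linearFun c) l₁ l₂)
    wα wv c₁ c₂
  rw [r₁, r₂, hQ₁, hQ₂] at key
  exact key

end Bracket

section Main

lemma fderiv_mem_submodule {V W : Type*} [NormedAddCommGroup V] [NormedSpace ℝ V]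
    [FiniteDimensional ℝ V] [NormedAddCommGroup W] [NormedSpace ℝ W] (K : Submodule ℝ V)
    {f : W → V} (hf : ∀ t, f t ∈ K) (t w : W) : fderiv ℝ f t w ∈ K := by
  by_cases hd : DifferentiableAt ℝ f t
  · by_contra hw
    obtain ⟨φ, hφ, hK⟩ := K.exists_le_ker_of_notMem hw
    have h₁ := (φ.toContinuousLinearMap.hasFDerivAt.comp t hd.hasFDerivAt).fderiv
    have h₂ : φ.toContinuousLinearMap ∘ f = fun _ => (0 : ℝ) := by
      funext t
      exact hK (hf t)
    rw [h₂, fderiv_fun_const] at h₁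
    exact hφ (congrArg (fun L => L w) h₁).symm
  · rw [fderiv_zero_of_not_differentiableAt hd]
    exact K.zero_mem

variable {E : Type*} [NormedAddCommGroup E] [NormedSpace ℝ E]
  {H : Type*} [TopologicalSpace H] (I : ModelWithCorners ℝ E H) {h : ℕ}
  {M : Type*} [TopologicalSpace M] [ChartedSpace H M]

/-- The fiberwise composition of the lift to `M × ℝ^h` and of the conformal change by `τ`. -/
noncomputable def conformalInvariantLift (τ : RSpace h → ℝ) (p : M × RSpace h) :
    StableBig I h p.1 →ₗ[ℝ] Big (I.prod 𝓘(ℝ, RSpace h)) p :=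
  (conformalMap (I.prod 𝓘(ℝ, RSpace h)) (fun p => τ p.2) p).comp (invariantLift I h p)

lemma conformalChange_invariantExtension (τ : RSpace h → ℝ)
    (J : Π x : M, Submodule ℝ (StableBig I h x)) (p : M × RSpace h) :
    conformalChange (I.prod 𝓘(ℝ, RSpace h)) (fun p => τ p.2) (invariantExtension I h J) p
      = (J p.1).map (conformalInvariantLift I τ p) :=
  (Submodule.map_comp _ _ _).symm

lemma bigMetric_conformalInvariantLift (τ : RSpace h → ℝ) (p : M × RSpace h)
    (a b : StableBig I h p.1) :
    bigMetric (I.prod 𝓘(ℝ, RSpace h)) p (conformalInvariantLift I τ p a)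
      (conformalInvariantLift I τ p b) = Real.exp (τ p.2) * stableMetric I h p.1 a b := by
  have e : bigMetric (I.prod 𝓘(ℝ, RSpace h)) p (conformalInvariantLift I τ p a)
      (conformalInvariantLift I τ p b)
      = (1 / 2) * (Real.exp (τ p.2) * (b.2.1 a.1.1 + inner ℝ b.2.2 a.1.2)
        + Real.exp (τ p.2) * (a.2.1 b.1.1 + inner ℝ a.2.2 b.1.2)) := rfl
  rw [e, stableMetric, real_inner_comm a.1.2, real_inner_comm b.1.2]
  ring

variable [FiniteDimensional ℝ E]

lemma conformalInvariantLift_bijective (τ : RSpace h → ℝ) (p : M × RSpace h) :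
    Bijective (conformalInvariantLift I τ p) := by
  have e : ∀ a : StableModel E h, (conformalInvariantLift I τ p a : BigModel (E × RSpace h))
      = modelTwist (τ p.2) (modelLift E h a) := fun _ => rfl
  have hT : Bijective (modelTwist (V := E × RSpace h) (τ p.2)) :=
    bijective_iff_has_inverse.2 ⟨modelTwist (-τ p.2), modelTwist_neg_modelTwist _, fun b => by
      simpa using modelTwist_neg_modelTwist (-τ p.2) b⟩
  exact hT.comp (modelLift E h).bijective

lemma isMaximalIsotropic_map (τ : RSpace h → ℝ) (p : M × RSpace h)
    {K : Submodule ℝ (StableBig I h p.1)} (hK : IsMaximalIsotropic (stableMetric I h p.1) K) :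
    IsMaximalIsotropic (bigMetric (I.prod 𝓘(ℝ, RSpace h)) p)
      (K.map (conformalInvariantLift I τ p)) := by
  refine ⟨?_, fun W hW hle => ?_⟩
  · rintro _ ⟨a, ha, rfl⟩ _ ⟨b, hb, rfl⟩
    rw [bigMetric_conformalInvariantLift, hK.prop a ha b hb, mul_zero]
  · have hc : W.comap (conformalInvariantLift I τ p) ≤ K := by
      refine hK.le_of_ge (fun a ha b hb => ?_) (Submodule.map_le_iff_le_comap.1 hle)
      have h₁ := hW _ ha _ hb
      rw [bigMetric_conformalInvariantLift] at h₁
      exact (mul_eq_zero.1 h₁).resolve_left (Real.exp_ne_zero _)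
    intro w hw
    obtain ⟨a, rfl⟩ := (conformalInvariantLift_bijective I τ p).2 w
    exact ⟨a, hc hw, rfl⟩

variable [IsManifold I ∞ M] [I.Boundaryless]

lemma smoothBigOn_conformalLift_const (c : Fin h → ℝ) {s : Π x : M, StableBig I h x} {U : Set M}
    (hU : IsOpen U) (hs : SmoothStableOn I h s U) :
    SmoothBigOn (I.prod 𝓘(ℝ, RSpace h)) (conformalLift I h (linearFun c) fun _ => s)
      (Prod.fst ⁻¹' U) := by
  rw [smoothBigOn_iff _ (hU.preimage continuous_fst)]
  rintro ⟨x, t⟩ hx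
  rw [contDiffAt_conformalLift_iff]
  exact ((smoothStableOn_iff I h hU).1 hs x hx).comp (extChartAt I x x, t) contDiffAt_fst

lemma IsStableAlmostDirac.isAlmostDirac {J : Π x : M, Submodule ℝ (StableBig I h x)}
    (hJ : IsStableAlmostDirac I h J) (c : Fin h → ℝ) :
    IsAlmostDirac (I.prod 𝓘(ℝ, RSpace h)) (conformalChange (I.prod 𝓘(ℝ, RSpace h))
      (fun p => linearFun c p.2) (invariantExtension I h J)) := by
  refine ⟨fun p => ?_, fun p => ?_⟩
  · obtain ⟨U, hU, hp, r, e, he, hfr⟩ := hJ.isSmoothSubbundle p.1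
    refine ⟨Prod.fst ⁻¹' U, hU.preimage continuous_fst, hp, r,
      fun i => conformalLift I h (linearFun c) fun _ => e i,
      fun i => smoothBigOn_conformalLift_const I c hU (he i), fun q hq => ⟨?_, ?_⟩⟩
    · exact (hfr q.1 hq).1.map' (conformalInvariantLift I (linearFun c) q)
        (LinearMap.ker_eq_bot.2 (conformalInvariantLift_bijective I _ q).1)
    · rw [conformalChange_invariantExtension I (linearFun c) J q, ← (hfr q.1 hq).2,
        Submodule.map_span, ← range_comp]
      rfl
  · rw [conformalChange_invariantExtension]
    exact isMaximalIsotropic_map I (linearFun c) p (hJ.isMaximalIsotropic p.1)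

/-- For families of sections of `J`, the Courant bracket on `M × ℝ^h` lies in the conformal change
of the extension of `J` if and only if the Wade bracket lies in `J`. -/
lemma courantBracket_conformalLift_mem_iff {J : Π x : M, Submodule ℝ (StableBig I h x)}
    (hJ : IsStableAlmostDirac I h J) {c : Fin h → ℝ}
    {s₁ s₂ : RSpace h → Π x : M, StableBig I h x} {x : M} {t : RSpace h}
    (h₁ : ContDiffAt ℝ ∞ (fun q : E × RSpace h => stableInChart I h (s₁ q.2) x q.1)
      (extChartAt I x x, t))
    (h₂ : ContDiffAt ℝ ∞ (fun q : E × RSpace h => stableInChart I h (s₂ q.2) x q.1)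
      (extChartAt I x x, t))
    (m₁ : ∀ t, s₁ t x ∈ J x) (m₂ : ∀ t, s₂ t x ∈ J x) :
    courantBracket (I.prod 𝓘(ℝ, RSpace h)) (conformalLift I h (linearFun c) s₁)
        (conformalLift I h (linearFun c) s₂) (x, t) ∈
        conformalChange (I.prod 𝓘(ℝ, RSpace h)) (fun p => linearFun c p.2)
          (invariantExtension I h J) (x, t) ↔
      wadeBracket I h (linearFun c) (s₁ t) (s₂ t) x ∈ J x := by
  have n (s : RSpace h → Π x : M, StableBig I h x) (m : ∀ t, s t x ∈ J x) (w : RSpace h) :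
      ∃ Q ∈ J x, paramDeriv I s x t w = Q :=
    ⟨_, fderiv_mem_submodule (V := StableModel E h) (J x) m t w, rfl⟩
  have iso := (hJ.isMaximalIsotropic x).prop
  obtain ⟨Q₁, hQ₁, e₁⟩ := n s₁ m₁ (s₂ t x).1.2
  obtain ⟨Q₂, hQ₂, e₂⟩ := n s₂ m₂ (s₁ t x).1.2
  have z₁ (w : RSpace h) : stableModelMetric (paramDeriv I s₁ x t w) (s₂ t x) = 0 := by
    obtain ⟨Q, hQ, e⟩ := n s₁ m₁ w
    rw [e]
    exact iso Q hQ _ (m₂ t)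
  have z₂ (w : RSpace h) : stableModelMetric (paramDeriv I s₂ x t w) (s₁ t x) = 0 := by
    obtain ⟨Q, hQ, e⟩ := n s₂ m₂ w
    rw [e]
    exact iso Q hQ _ (m₁ t)
  have key := courantBracket_conformalLift I (c := c) h₁ h₂ z₁ z₂ e₁ e₂
  rw [key, conformalChange_invariantExtension I (linearFun c) J (x, t)]
  have h₃ := (conformalInvariantLift_bijective I (linearFun c) (x, t)).1.mem_set_image
    (s := (J x : Set (StableBig I h x)))
    (a := wadeBracket I h (linearFun c) (s₁ t) (s₂ t) x + Q₂ - Q₁)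
  refine h₃.trans ?_
  rw [SetLike.mem_coe, sub_eq_add_neg, (J x).add_mem_iff_left ((J x).neg_mem hQ₁),
    (J x).add_mem_iff_left hQ₂]

end Main

end StableDirac

theorem proposition2p2
    {E : Type*} [NormedAddCommGroup E] [NormedSpace ℝ E] [FiniteDimensional ℝ E]
    {H : Type*} [TopologicalSpace H] (I : ModelWithCorners ℝ E H) [I.Boundaryless]
    {M : Type*} [TopologicalSpace M] [T2Space M] [ChartedSpace H M] [IsManifold I ∞ M]
    (h : ℕ) (c : Fin h → ℝ)
    (J : Π x : M, Submodule ℝ (StableDirac.StableBig I h x))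
    (hJ : StableDirac.IsStableAlmostDirac I h J) :
    StableDirac.IsStableDiracJacobi I h c J ↔
      StableDirac.IsDirac (I.prod 𝓘(ℝ, StableDirac.RSpace h))
        (StableDirac.conformalChange (I.prod 𝓘(ℝ, StableDirac.RSpace h))
          (fun p => StableDirac.linearFun c p.2)
          (StableDirac.invariantExtension I h J)) := by
  constructor
  · intro hD
    refine ⟨hJ.isAlmostDirac I c, fun S₁ S₂ hS₁ hS₂ m₁ m₂ p => ?_⟩
    have lift_eq (S : Π p : M × StableDirac.RSpace h,
        StableDirac.Big (I.prod 𝓘(ℝ, StableDirac.RSpace h)) p)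
        (m : ∀ p, S p ∈ StableDirac.conformalChange (I.prod 𝓘(ℝ, StableDirac.RSpace h))
          (fun p => StableDirac.linearFun c p.2) (StableDirac.invariantExtension I h J) p) :
        ∃ s : StableDirac.RSpace h → Π x : M, StableDirac.StableBig I h x,
          (∀ t x, s t x ∈ J x) ∧ StableDirac.conformalLift I h (StableDirac.linearFun c) s = S := by
      have m' (p : M × StableDirac.RSpace h) : ∃ e ∈ J p.1,
          StableDirac.conformalInvariantLift I (StableDirac.linearFun c) p e = S p := by
        have mp := m p
        rw [StableDirac.conformalChange_invariantExtension I (StableDirac.linearFun c) J p] at mp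
        exact mp
      choose e he using m'
      exact ⟨fun t x => e (x, t), fun t x => (he (x, t)).1, funext fun p => (he p).2⟩
    obtain ⟨s₁, n₁, rfl⟩ := lift_eq S₁ m₁
    obtain ⟨s₂, n₂, rfl⟩ := lift_eq S₂ m₂
    rw [StableDirac.smoothBigOn_iff _ isOpen_univ] at hS₁ hS₂
    have k₁ (x t) := (StableDirac.contDiffAt_conformalLift_iff I c s₁ x t).1 (hS₁ (x, t) trivial)
    have k₂ (x t) := (StableDirac.contDiffAt_conformalLift_iff I c s₂ x t).1 (hS₂ (x, t) trivial)
    refine (StableDirac.courantBracket_conformalLift_mem_iff I hJ (k₁ p.1 p.2) (k₂ p.1 p.2)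
      (n₁ · p.1) (n₂ · p.1)).2 ?_
    refine hD.closed (s₁ p.2) (s₂ p.2) ?_ ?_ (n₁ p.2) (n₂ p.2) p.1
    · exact (StableDirac.smoothStableOn_iff I h isOpen_univ).2 fun x _ =>
        (k₁ x p.2).comp (extChartAt I x x) (contDiffAt_id.prodMk contDiffAt_const)
    · exact (StableDirac.smoothStableOn_iff I h isOpen_univ).2 fun x _ =>
        (k₂ x p.2).comp (extChartAt I x x) (contDiffAt_id.prodMk contDiffAt_const)
  · intro hD
    refine ⟨hJ, fun s₁ s₂ hs₁ hs₂ m₁ m₂ x => ?_⟩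
    have k₁ := ((StableDirac.smoothStableOn_iff I h isOpen_univ).1 hs₁ x trivial).comp
      (extChartAt I x x, (0 : StableDirac.RSpace h)) contDiffAt_fst
    have k₂ := ((StableDirac.smoothStableOn_iff I h isOpen_univ).1 hs₂ x trivial).comp
      (extChartAt I x x, (0 : StableDirac.RSpace h)) contDiffAt_fst
    refine (StableDirac.courantBracket_conformalLift_mem_iff I hJ (c := c) (s₁ := fun _ => s₁)
      (s₂ := fun _ => s₂) (t := 0) k₁ k₂ (fun _ => m₁ x) (fun _ => m₂ x)).1 ?_
    have mem (s : Π x : M, StableDirac.StableBig I h x) (m : ∀ x, s x ∈ J x)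
        (p : M × StableDirac.RSpace h) :
        StableDirac.conformalLift I h (StableDirac.linearFun c) (fun _ => s) p ∈
          StableDirac.conformalChange (I.prod 𝓘(ℝ, StableDirac.RSpace h))
          (fun p => StableDirac.linearFun c p.2) (StableDirac.invariantExtension I h J) p :=
      ⟨_, ⟨s p.1, m p.1, rfl⟩, rfl⟩
    exact hD.closed _ _ (StableDirac.smoothBigOn_conformalLift_const I c isOpen_univ hs₁)
      (StableDirac.smoothBigOn_conformalLift_const I c isOpen_univ hs₂) (mem s₁ m₁) (mem s₂ m₂) _
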